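/- For complex numbers $x,q$ and $n\in\mathbb{N}=\{0,1,2,\dots\}$ let $(x;q)_n=\prod_{k=0}^{n-1}(1-xq^k)$, and write $$\left[\begin{matrix}a_1,\dots,a_r\\ b_1,\dots,b_s\end{matrix}\,\middle|\,q\right]_n=\frac{(a_1;q)_n\cdots(a_r;q)_n}{(b_1;q)_n\cdots(b_s;q)_n},\qquad {}_4\phi_3\left[\begin{matrix}a_0,a_1,a_2,a_3\\ b_1,b_2,b_3\end{matrix}\,\middle|\,q;z\right]=\sum_{k=0}^{\infty}\left[\begin{matrix}a_0,a_1,a_2,a_3\\ q,b_1,b_2,b_3\end{matrix}\,\middle|\,q\right]_kz^k .$$ Let $\chi(k)=\frac{1+(-1)^k}{2}$ for $k\in\mathbb{Z}$. Let $q,a,c$ be nonzero complex numbers and $n,\ell,m$ nonnegative integers such that no denominator below vanishes. (For the series on the left this is required of the terms $k\le n$ only, the terms $k>n$ being $0$ because of the parameter $q^{-n}$. In the double sum, the summands with $i+j>n$, where $(q^{-n};q)_i(q^{i-n};q)_j=0$, and those with $n-i-j$ odd, where $\chi(n-i-j)=0$, are read as $0$; for the factor with base $q^2$ the requirement concerns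 only the pairs $(i,j)$ with $i+j\le n$ and $n-i-j$ even, and for the factors of orders $i$ and $j$ it concerns $i\le\min(\ell,n)$ and $j\le\min(m,n)$.) Then $$\begin{aligned} &{}_4\phi_3\left[\begin{matrix}q^{-n},\,a,\,c,\,-q^{1+\ell+m-n}/(ac)\\ q^{1+\ell-n}/a,\,q^{1+m-n}/c,\,-ac\end{matrix}\,\middle|\,q;q\right] =\left[\begin{matrix}q^{1+\ell-n}/a^2,\,-q/a\\ q^{1+\ell}/a^2,\,-q^{1-n}/a\end{matrix}\,\middle|\,q\right]_{\ell} \left[\begin{matrix}-a,\,q^{-m}c^2\\ -ac,\,q^{-m}c\end{matrix}\,\middle|\,q\right]_{n}\\ &\quad\times\sum_{i=0}^{\ell}\sum_{j=0}^{m}(-1)^{i+j}q^{ni+(n-i-j)(j-m)+\binom{j+1}{2}}a^ic^{n-i}\, \frac{1-q^{2i-2\ell-1}a^2}{1-q^{-2\ell-1}a^2} \left[\begin{matrix}q^{-\ell},\,q^{-n},\,q^{-2\ell-1}a^2\\ q,\,q^{n-2\ell}a^2,\,q^{-\ell}a^2\end{matrix}\,\middle|\,q\right]_i\\ &\quad\times\left[\begin{matrix}q^{-m},\,q^{i-n},\,q^{1+2\ell-n-i}/a^2,\,q^{-m}c,\,-q^{-m}c\\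 q,\,q^{1+\ell-n}/a,\,-q^{1+\ell-n}/a,\,q^{-m}c^2,\,q^{j-2m-1}c^2\end{matrix}\,\middle|\,q\right]_j \left[\begin{matrix}q,\,q^{2+2\ell+2m-2n}/(a^2c^2)\\ q^{2+2\ell-2n+2j}/a^2,\,q^{1-2m+2j}c^2\end{matrix}\,\middle|\,q^2\right]_{\frac{n-i-j}{2}}\chi(n-i-j). \end{aligned}$$ -/

import Mathlib

/-- The `q`-shifted factorial `(x;q)_n = ∏_{k<n} (1 - x q^k)`. -/
noncomputable def qPoch (x q : ℂ) (n : ℕ) : ℂ :=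
  ∏ k ∈ Finset.range n, (1 - x * q ^ k)

/-- The fraction form: `(a;q)_n (b;q)_n ⋯ (c;q)_n / ((α;q)_n (β;q)_n ⋯ (γ;q)_n)`, where `num` lists
`a, b, …, c` and `den` lists `α, β, …, γ`. -/
noncomputable def qFrac (q : ℂ) (num den : List ℂ) (n : ℕ) : ℂ :=
  (num.map fun x => qPoch x q n).prod / (den.map fun x => qPoch x q n).prod

/-- None of the `q`-shifted factorials `(β;q)_n` with `β` in the list `den` vanishes. -/
def NoZeroDen (q : ℂ) (den : List ℂ) (n : ℕ) : Prop :=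
  ∀ x ∈ den, qPoch x q n ≠ 0

/-- The basic hypergeometric series with numerator parameters `num`, denominator parameters `den`,
base `q` and argument `z`: the sum over `k ≥ 0` of `(num;q)_k / ((q;q)_k (den;q)_k) * z ^ k`.
It has finite support if some numerator parameter is `q ^ (-n)`. -/
noncomputable def basicHyp (q z : ℂ) (num den : List ℂ) : ℂ :=
  ∑' k : ℕ, qFrac q num (q :: den) k * z ^ k

/-- The parity factor `χ(n) = (1 + (-1)^n) / 2`. -/
noncomputable def parityChi (n : ℤ) : ℂ := (1 + (-1) ^ n) / 2

/-!
The identity is a chain of three expansions of terminating basic hypergeometric series. Write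
`(x)_k` for `(x;q)_k`.

* Sears' transformation (`sears`) turns the balanced series on the left into the product of
  `[-a, q^{-m}c²; -ac, q^{-m}c]_n` and the series with numerator parameters `q^{-n}`,
  `q^{1+ℓ-n}/a²`, `c`, `-q^{-m}c` and denominator parameters `q^{1+ℓ-n}/a`, `-q^{1-n}/a`,
  `q^{-m}c²`.
* A very-well-poised `₆φ₅` sum (`sixPhiFive`) with base parameter `q^{-2ℓ-1}a²` expands
  `(q^{1+ℓ-n}/a²)_k / (-q^{1-n}/a)_k` and produces the sum over `i` (`base_switch`). The new inner
  series have the two opposite denominator parameters `±q^{1+ℓ-n}/a`.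
* The same `₆φ₅` sum with base parameter `q^{-2m-1}c²` expands `(c)_k / (q^{-m}c²)_k` and produces
  the sum over `j`. What is left are series of length `n - i - j` with the numerator parameters
  `±q^{j-m}c` and the denominator parameter `q^{2j-2m}c²`; these are evaluated by Andrews'
  `q`-analogue of Watson's sum (`qWatson`), which vanishes for odd length
  (`quadratic_expansion`).

The summation formulas `qSaalschutz` (from which `sears` follows), `sixPhiFive` and `qWatson` are
proved by induction on the length, each with an explicit telescoping certificate.

These steps divide by products that may vanish although no denominator in the statement does. They
are therefore carried out for generic parameters only (`lhsSum_eq_rhsSum_of_generic`). Generic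
parameters are dense (`frequently_isGeneric`), and both sides are continuous at every point where
their own denominators do not vanish, which gives the general case.
-/

section

open Finset Filter Topology

variable {q : ℂ}

/-! ### Products `(x;q)_n` and generic parameters -/

theorem qPoch_zero (x q : ℂ) : qPoch x q 0 = 1 := by simp [qPoch]

theorem qPoch_succ (x q : ℂ) (n : ℕ) :
    qPoch x q (n + 1) = qPoch x q n * (1 - x * q ^ n) := by
  simp [qPoch, prod_range_succ]

theorem qPoch_add (x q : ℂ) (m n : ℕ) :
    qPoch x q (m + n) = qPoch x q m * qPoch (x * q ^ m) q n := by
  simp only [qPoch, prod_range_add, pow_add, mul_assoc]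

theorem qPoch_mul_one_sub (x q : ℂ) (n : ℕ) :
    qPoch x q n * (1 - x * q ^ n) = (1 - x) * qPoch (x * q) q n := by
  rw [← qPoch_succ, add_comm, qPoch_add]
  simp [qPoch]

/-- The product `(x;q)_n` read backwards, as a product in base `q` again. -/
theorem qPoch_reverse (hq : q ≠ 0) {x : ℂ} (hx : x ≠ 0) (n : ℕ) :
    qPoch x q n = qPoch (q / (x * q ^ n)) q n * ((-x) ^ n * q ^ n.choose 2) := by
  have key : (-x) ^ n * q ^ n.choose 2 = ∏ k ∈ range n, (-x * q ^ k) := by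
    rw [prod_mul_distrib, prod_const, card_range, prod_pow_eq_pow_sum, Finset.sum_range_id,
      Nat.choose_two_right]
  rw [key, qPoch, qPoch, ← prod_range_reflect (fun k => 1 - q / (x * q ^ n) * q ^ k),
    ← prod_mul_distrib]
  refine prod_congr rfl fun k hk => ?_
  obtain ⟨r, rfl⟩ := Nat.exists_eq_add_of_lt (mem_range.1 hk)
  rw [show k + r + 1 - 1 - k = r by omega]
  field_simp
  ring

theorem qPoch_inv_pow_eq_zero (hq : q ≠ 0) {n k : ℕ} (h : n < k) :
    qPoch (q ^ n)⁻¹ q k = 0 := by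
  refine prod_eq_zero (mem_range.2 h) ?_
  field_simp
  simp

/-- `x` is not an integral power of `q`. Then no `(x q^k; q)_n` with `k ∈ ℤ` vanishes, and the
property passes to `x⁻¹` and to `x q^k`. -/
def QFree (q x : ℂ) : Prop := ∀ k : ℤ, x * q ^ k ≠ 1

theorem QFree.qPoch_ne_zero {x : ℂ} (h : QFree q x) (n : ℕ) : qPoch x q n ≠ 0 := by
  refine prod_ne_zero_iff.2 fun k _ => ?_
  have := h k
  rw [zpow_natCast] at this
  exact sub_ne_zero.2 this.symm

theorem QFree.mul_zpow (hq : q ≠ 0) {x : ℂ} (h : QFree q x) (k : ℤ) : QFree q (x * q ^ k) := by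
  intro j
  rw [mul_assoc, ← zpow_add₀ hq]
  exact h _

theorem QFree.mul_pow (hq : q ≠ 0) {x : ℂ} (h : QFree q x) (k : ℕ) : QFree q (x * q ^ k) := by
  simpa using h.mul_zpow hq k

theorem QFree.one_sub_ne_zero {x : ℂ} (h : QFree q x) : 1 - x ≠ 0 := by
  have := h 0
  rw [zpow_zero, mul_one] at this
  exact sub_ne_zero.2 this.symm

theorem QFree.inv {x : ℂ} (h : QFree q x) : QFree q x⁻¹ := by
  intro k hk
  apply h (-k)
  rw [← inv_inj, mul_inv, zpow_neg, inv_inv, hk, inv_one]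

theorem qPoch_self_ne_zero (h1 : ∀ k : ℕ, q ^ (k + 1) ≠ 1) (n : ℕ) : qPoch q q n ≠ 0 := by
  refine prod_ne_zero_iff.2 fun k _ => ?_
  have := h1 k
  rw [pow_succ'] at this
  exact sub_ne_zero.2 this.symm

theorem one_sub_inv_pow_ne_zero (h1 : ∀ k : ℕ, q ^ (k + 1) ≠ 1) (n : ℕ) :
    1 - (q ^ (n + 1))⁻¹ ≠ 0 := by
  intro h
  exact h1 n (by rw [← inv_inj, inv_one]; exact (sub_eq_zero.1 h).symm)

theorem QFree.of_sq {x : ℂ} (h : QFree q (x ^ 2)) : QFree q x := by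
  intro k hk
  apply h (2 * k)
  rw [mul_comm 2 k, zpow_mul, zpow_ofNat, ← _root_.mul_pow, hk, one_pow]

theorem qPoch_mul_neg (x q : ℂ) (n : ℕ) :
    qPoch x q n * qPoch (-x) q n = qPoch (x ^ 2) (q ^ 2) n := by
  simp only [qPoch, ← prod_mul_distrib]
  exact prod_congr rfl fun k _ => by ring

theorem QFree.sq_base {x : ℂ} (h : QFree q x) : QFree (q ^ 2) x := by
  intro k
  have := h (2 * k)
  rwa [zpow_mul, zpow_ofNat] at this

/-! ### Creative telescoping and the classical summation formulas -/

/-- The engine of the Wilf–Zeilberger method: if `f - ρ g` is the difference of a sequence `G` that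
vanishes at both ends of the range, then `∑ f = ρ ∑ g`. -/
theorem sum_eq_mul_sum_of_telescope {f g G : ℕ → ℂ} {ρ : ℂ} {n : ℕ}
    (h : ∀ k, f k - ρ * g k = G (k + 1) - G k) (h0 : G 0 = 0) (hn : G n = 0) :
    ∑ k ∈ range n, f k = ρ * ∑ k ∈ range n, g k := by
  rw [← sub_eq_zero, mul_sum, ← sum_sub_distrib, sum_congr rfl fun k _ => h k, sum_range_sub, h0,
    hn, sub_zero]

/-- The `q`-Pfaff–Saalschütz sum: a terminating balanced `₃φ₂` series is a quotient of products.
The recurrence in `N` comes with the certificate `G` of the proof. -/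
theorem qSaalschutz (hq : q ≠ 0) (h1 : ∀ k : ℕ, q ^ (k + 1) ≠ 1) {a b c : ℂ} (ha : a ≠ 0)
    (hb : b ≠ 0) (hc : c ≠ 0) (hcf : QFree q c) (hd : QFree q (c / (a * b))) (N : ℕ) :
    ∑ k ∈ range (N + 1), qPoch (q ^ N)⁻¹ q k * qPoch a q k * qPoch b q k /
        (qPoch q q k * qPoch c q k * qPoch (a * b * q / (c * q ^ N)) q k) * q ^ k =
      qPoch (c / a) q N * qPoch (c / b) q N / (qPoch c q N * qPoch (c / (a * b)) q N) := by
  induction N with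
  | zero => simp [qPoch_zero]
  | succ N ih =>
    -- Both summands are multiples of `(x, a, b)_k / (q, c, d q)_k`, with `x` and `d` the parameters
    -- that depend on `N`.
    set x : ℂ := (q ^ (N + 1))⁻¹ with hx
    have hx0 : x ≠ 0 := inv_ne_zero (pow_ne_zero _ hq)
    have hxq : (q ^ N)⁻¹ = x * q := by rw [hx, pow_succ]; field_simp
    have hqN : q ^ N = 1 / (x * q) := by rw [← hxq]; simp
    set d : ℂ := a * b * q / (c * q ^ (N + 1)) with hd'
    have hdx : d = a * b * q * x / c := by rw [hd', hx]; field_simp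
    have hdf : QFree q d := by
      have := (hd.inv).mul_zpow hq (-N)
      convert this using 1
      rw [hd', pow_succ, zpow_neg, zpow_natCast]; field_simp
    have hdq : a * b * q / (c * q ^ N) = d * q := by rw [hd', pow_succ]; field_simp
    have hdqf : QFree q (d * q) := by simpa using hdf.mul_pow hq 1
    rw [hxq, hdq, sum_subset (range_mono (Nat.le_succ (N + 1)))] at ih
    swap
    · intro k _ hk
      rw [← hxq, qPoch_inv_pow_eq_zero hq (by simpa using hk)]
      simp
    have hx1 : 1 - x ≠ 0 := by
      rw [hx]; intro h
      exact h1 N (by rw [← inv_inj, inv_one]; exact (sub_eq_zero.1 h).symm)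
    have hd1 := hdf.one_sub_ne_zero
    have hc1 : 1 - c * q ^ N ≠ 0 := (hcf.mul_pow hq N).one_sub_ne_zero
    have hcd1 : 1 - c / (a * b) * q ^ N ≠ 0 := (hd.mul_pow hq N).one_sub_ne_zero
    have tel := sum_eq_mul_sum_of_telescope (n := N + 1 + 1)
      (f := fun k => qPoch x q k * qPoch a q k * qPoch b q k /
        (qPoch q q k * qPoch c q k * qPoch d q k) * q ^ k)
      (g := fun k => qPoch (x * q) q k * qPoch a q k * qPoch b q k /
        (qPoch q q k * qPoch c q k * qPoch (d * q) q k) * q ^ k)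
      (ρ := (1 - c / a * q ^ N) * (1 - c / b * q ^ N) /
        ((1 - c * q ^ N) * (1 - c / (a * b) * q ^ N)))
      (G := fun k => 1 / ((1 - d) * (1 - x) * (1 - c * q ^ N)) *
        ((1 - q ^ k) * (1 - c * q ^ k / q) * (1 - d * q ^ k) *
          (qPoch x q k * qPoch a q k * qPoch b q k) /
          (qPoch q q k * qPoch c q k * qPoch (d * q) q k)))
      ?_ (by simp) (by simp [hx, qPoch_inv_pow_eq_zero hq (Nat.lt_succ_self (N + 1))])
    · rw [tel, ih]
      simp only [qPoch_succ]
      rw [div_mul_div_comm]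
      congr 1 <;> ring
    · intro k
      have e1 : qPoch (x * q) q k = qPoch x q k * (1 - x * q ^ k) / (1 - x) := by
        rw [qPoch_mul_one_sub]; field_simp
      have e2 : qPoch d q k = (1 - d) * qPoch (d * q) q k / (1 - d * q ^ k) := by
        rw [← qPoch_mul_one_sub]
        have := (hdf.mul_pow hq k).one_sub_ne_zero
        field_simp
      have n1 := (hdf.mul_pow hq k).one_sub_ne_zero
      have n2 := (hcf.mul_pow hq k).one_sub_ne_zero
      have n3 := qPoch_self_ne_zero h1 k
      have n4 := hcf.qPoch_ne_zero k
      have n5 := hdqf.qPoch_ne_zero k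
      have n6 : 1 - q * q ^ k ≠ 0 := by
        have := h1 k; rw [pow_succ'] at this; exact sub_ne_zero.2 this.symm
      have n7 : 1 - d * q * q ^ k ≠ 0 := (hdqf.mul_pow hq k).one_sub_ne_zero
      simp only [qPoch_succ, e1, e2, pow_succ]
      generalize qPoch x q k = X at *
      generalize qPoch a q k = Pa at *
      generalize qPoch b q k = Pb at *
      generalize qPoch c q k = Pc at *
      generalize qPoch q q k = Pq at *
      generalize qPoch (d * q) q k = Pd at *
      have hy0 : q ^ k ≠ 0 := pow_ne_zero _ hq
      generalize q ^ k = y at *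
      have hdz : d ≠ 0 := by rw [hdx]; simp [ha, hb, hq, hx0, hc]
      -- Eliminating `a` in favour of `d` makes all factors polynomial.
      have ea : a = d * c / (b * q * x) := by rw [hdx]; field_simp
      have r1 : c / a * q ^ N = b / d := by rw [hqN, hdx]; field_simp
      have r2 : c / (a * b) * q ^ N = 1 / d := by rw [hqN, hdx]; field_simp
      rw [r1, r2]
      rw [r2] at hcd1
      rw [hqN] at *
      have hcx : x * q - c ≠ 0 := by
        intro h; apply hc1; field_simp; rw [h, mul_zero]
      have hd2 : d - 1 ≠ 0 := by
        intro h; apply hd1; linear_combination -h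
      clear_value d x
      clear ih hdx r1 r2 hd' hx e1 e2 hdq hd hcd1 hc1
      subst ea
      have : 1 - c * (1 / (x * q)) = (x * q - c) / (x * q) := by field_simp
      rw [this]
      have : 1 - 1 / d = (d - 1) / d := by field_simp
      rw [this]
      have s1 : 1 - y * q = 1 - q * y := by ring
      have s2 : 1 - c * (y * q) / q = 1 - c * y := by field_simp
      have s3 : 1 - d * (y * q) = 1 - d * q * y := by ring
      rw [s1, s2, s3]
      generalize 1 - d * q * y = D1 at *
      generalize 1 - q * y = D2 at *
      generalize 1 - c * y = D3 at *
      field_simp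
      ring

/-- Rogers' terminating very-well-poised `₆φ₅` sum with base parameter `δ² / q`, in the special case
that one of the free parameters is `δ`, which cancels against its partner in the denominator. -/
theorem sixPhiFive (hq : q ≠ 0) (h1 : ∀ k : ℕ, q ^ (k + 1) ≠ 1) {b δ : ℂ} (hb : b ≠ 0)
    (hδf : QFree q (δ ^ 2)) (hδb : QFree q (δ ^ 2 / b)) (N : ℕ) :
    ∑ j ∈ range (N + 1), (1 - δ ^ 2 / q * q ^ (2 * j)) / (1 - δ ^ 2 / q) *
        (qPoch (δ ^ 2 / q) q j * qPoch b q j * qPoch (q ^ N)⁻¹ q j /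
          (qPoch q q j * qPoch (δ ^ 2 / b) q j * qPoch (δ ^ 2 * q ^ N) q j)) *
        (δ * q ^ N / b) ^ j =
      qPoch (δ ^ 2) q N * qPoch (δ / b) q N / (qPoch (δ ^ 2 / b) q N * qPoch δ q N) := by
  induction N with
  | zero =>
    have : 1 - δ ^ 2 / q ≠ 0 := by
      simpa [div_eq_mul_inv] using (hδf.mul_zpow hq (-1)).one_sub_ne_zero
    simp [qPoch_zero, this]
  | succ N ih =>
    set x : ℂ := (q ^ (N + 1))⁻¹ with hx
    have hx0 : x ≠ 0 := inv_ne_zero (pow_ne_zero _ hq)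
    have hxq : (q ^ N)⁻¹ = x * q := by rw [hx, pow_succ]; field_simp
    have hqN : q ^ N = 1 / (x * q) := by rw [← hxq]; simp
    have hx1 : 1 - x ≠ 0 := one_sub_inv_pow_ne_zero h1 N
    have hQ0 : q ^ N ≠ 0 := pow_ne_zero _ hq
    have hDf := hδf.mul_pow hq N
    have hDqf := hδf.mul_pow hq (N + 1)
    rw [hxq, sum_subset (range_mono (Nat.le_succ (N + 1)))] at ih
    swap
    · intro k _ hk
      rw [← hxq, qPoch_inv_pow_eq_zero hq (by simpa using hk)]
      simp
    have m1 := (hδb.mul_pow hq N).one_sub_ne_zero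
    have m2 := (hδf.of_sq.mul_pow hq N).one_sub_ne_zero
    have m3 := hDf.one_sub_ne_zero
    have m4 : 1 - δ ^ 2 / q ≠ 0 := by
      simpa [div_eq_mul_inv] using (hδf.mul_zpow hq (-1)).one_sub_ne_zero
    have tel := sum_eq_mul_sum_of_telescope (n := N + 1 + 1)
      (f := fun j => (1 - δ ^ 2 / q * q ^ (2 * j)) / (1 - δ ^ 2 / q) *
        (qPoch (δ ^ 2 / q) q j * qPoch b q j * qPoch x q j /
          (qPoch q q j * qPoch (δ ^ 2 / b) q j * qPoch (δ ^ 2 * q ^ (N + 1)) q j)) *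
        (δ * q ^ (N + 1) / b) ^ j)
      (g := fun j => (1 - δ ^ 2 / q * q ^ (2 * j)) / (1 - δ ^ 2 / q) *
        (qPoch (δ ^ 2 / q) q j * qPoch b q j * qPoch (x * q) q j /
          (qPoch q q j * qPoch (δ ^ 2 / b) q j * qPoch (δ ^ 2 * q ^ N) q j)) *
        (δ * q ^ N / b) ^ j)
      (ρ := (1 - δ ^ 2 * q ^ N) * (1 - δ / b * q ^ N) /
        ((1 - δ ^ 2 / b * q ^ N) * (1 - δ * q ^ N)))
      (G := fun j => 1 / ((1 - δ ^ 2 / q) * (1 - x) * (1 - δ ^ 2 / b * q ^ N) * (1 - δ * q ^ N)) *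
        ((1 - q ^ j) * (1 - δ ^ 2 / b * q ^ j / q) * (1 - δ ^ 2 * q ^ N * q ^ j) *
          (1 - δ * q ^ j / q) *
          (qPoch (δ ^ 2 / q) q j * qPoch b q j * qPoch x q j) /
          (qPoch q q j * qPoch (δ ^ 2 / b) q j * qPoch (δ ^ 2 * q ^ (N + 1)) q j)) *
          (δ * q ^ N / b) ^ j)
      ?_ (by simp) (by simp [hx, qPoch_inv_pow_eq_zero hq (Nat.lt_succ_self (N + 1))])
    · rw [tel, ih]
      simp only [qPoch_succ]
      rw [div_mul_div_comm]
      congr 1 <;> ring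
    · intro k
      have e1 : qPoch (x * q) q k = qPoch x q k * (1 - x * q ^ k) / (1 - x) := by
        rw [qPoch_mul_one_sub]; field_simp
      have n1 := (hDf.mul_pow hq k).one_sub_ne_zero
      have e2 : qPoch (δ ^ 2 * q ^ N) q k =
          (1 - δ ^ 2 * q ^ N) * qPoch (δ ^ 2 * q ^ (N + 1)) q k /
            (1 - δ ^ 2 * q ^ N * q ^ k) := by
        rw [pow_succ q N, ← mul_assoc, ← qPoch_mul_one_sub]
        field_simp
      have n2 := (hδb.mul_pow hq k).one_sub_ne_zero
      have n3 := qPoch_self_ne_zero h1 k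
      have n4 := hδb.qPoch_ne_zero k
      have n5 := hDqf.qPoch_ne_zero k
      have n6 : 1 - q * q ^ k ≠ 0 := by
        have := h1 k; rw [pow_succ'] at this; exact sub_ne_zero.2 this.symm
      have n7 := (hDqf.mul_pow hq k).one_sub_ne_zero
      have e3 : (δ * q ^ (N + 1) / b) ^ k = (δ * q ^ N / b) ^ k * q ^ k := by
        rw [← mul_pow]; congr 1; ring
      have e4 : q ^ (2 * k) = q ^ k * q ^ k := by ring
      simp only [qPoch_succ, e1, e2, e3, e4]
      simp only [pow_succ _ k]
      generalize qPoch x q k = P1 at *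
      generalize qPoch b q k = P2 at *
      generalize qPoch (δ ^ 2 / q) q k = P3 at *
      generalize qPoch q q k = P4 at *
      generalize qPoch (δ ^ 2 / b) q k = P5 at *
      generalize qPoch (δ ^ 2 * q ^ (N + 1)) q k = P6 at *
      generalize (δ * q ^ N / b) ^ k = Z at *
      have hy0 : q ^ k ≠ 0 := pow_ne_zero _ hq
      generalize q ^ k = y at *
      have s1 : 1 - y * q = 1 - q * y := by ring
      have s2 : 1 - δ ^ 2 / b * (y * q) / q = 1 - δ ^ 2 / b * y := by field_simp
      have s3 : 1 - δ ^ 2 * q ^ N * (y * q) = 1 - δ ^ 2 * q ^ (N + 1) * y := by ring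
      rw [s1, s2, s3]
      generalize 1 - δ ^ 2 * q ^ (N + 1) * y = D1 at *
      generalize 1 - q * y = D2 at *
      generalize 1 - δ ^ 2 / b * y = D3 at *
      have hxe : x = 1 / (q ^ N * q) := by rw [hqN]; field_simp
      clear_value x
      clear ih hxq hqN hx e1 e2 e3 e4 s1 s2 s3 hδf hδb hDf hDqf
      generalize q ^ N = Q at *
      subst hxe
      have t1 : 1 - 1 / (Q * q) = (q * Q - 1) / (Q * q) := by field_simp
      have t2 : 1 - δ ^ 2 / q = (q - δ ^ 2) / q := by field_simp
      have t3 : 1 - δ ^ 2 / b * Q = (b - δ ^ 2 * Q) / b := by field_simp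
      rw [t1] at hx1 ⊢
      rw [t2] at m4 ⊢
      rw [t3] at m1 ⊢
      have hx1' : q * Q - 1 ≠ 0 := (div_ne_zero_iff.1 hx1).1
      have m4' := (div_ne_zero_iff.1 m4).1
      have m1' := (div_ne_zero_iff.1 m1).1
      field_simp
      ring

/-- Andrews' terminating `q`-analogue of Watson's `₃F₂` sum, with `(u; q²)_k = (√u, -√u; q)_k` and
`(e; q²)_k = (√e, -√e; q)_k` written as products in base `q²`. The sum for `s + 2` is a
multiple of the sum for `s`, and the sum for `s = 1` is zero. -/
theorem qWatson (hq : q ≠ 0) (h1 : ∀ k : ℕ, q ^ (k + 1) ≠ 1) {e u : ℂ} (hu : u ≠ 0)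
    (he : QFree q e) (huf : QFree q u) (s : ℕ) :
    ∑ k ∈ range (s + 1), qPoch (q ^ s)⁻¹ q k * qPoch (e * q ^ s / q) q k * qPoch u (q ^ 2) k /
        (qPoch q q k * qPoch e (q ^ 2) k * qPoch u q k) * q ^ k =
      if Even s then u ^ (s / 2) * (qPoch q (q ^ 2) (s / 2) * qPoch (e / u) (q ^ 2) (s / 2)) /
        (qPoch e (q ^ 2) (s / 2) * qPoch (u * q) (q ^ 2) (s / 2)) else 0 := by
  induction s using Nat.twoStepInduction with
  | zero => simp [qPoch_zero]
  | one =>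
    have a1 := he.one_sub_ne_zero
    have a2 := huf.one_sub_ne_zero
    have a3 : 1 - q ≠ 0 := by
      have := h1 0
      simp only [zero_add, pow_one] at this
      exact sub_ne_zero.2 this.symm
    simp [sum_range_succ, qPoch]
    field_simp
    ring
  | more s ih _ =>
    set z : ℂ := (q ^ (s + 2))⁻¹ with hz
    set x : ℂ := e * q ^ s / q with hx
    have hz0 : z ≠ 0 := inv_ne_zero (pow_ne_zero _ hq)
    have hzq : (q ^ s)⁻¹ = z * q * q := by rw [hz, pow_add]; field_simp
    have hqs : q ^ s = 1 / (z * q * q) := by rw [← hzq]; simp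
    have hxq : e * q ^ (s + 2) / q = x * q * q := by rw [hx]; field_simp; ring
    have hex : e = x * z * q ^ 3 := by
      rw [hx, hqs]; field_simp
    have hxf : QFree q x := by
      have := (he.mul_pow hq s).mul_zpow hq (-1)
      rwa [zpow_neg_one, ← div_eq_mul_inv] at this
    have hxf1 : QFree q (x * q) := by simpa using hxf.mul_pow hq 1
    have hz1 : 1 - z ≠ 0 := one_sub_inv_pow_ne_zero h1 (s + 1)
    have hzz : z * q = (q ^ (s + 1))⁻¹ := by rw [hz, pow_succ]; field_simp
    have hz2 : 1 - z * q ≠ 0 := hzz ▸ one_sub_inv_pow_ne_zero h1 s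
    have huz : 1 - u * q ^ (s + 1) ≠ 0 := (huf.mul_pow hq (s + 1)).one_sub_ne_zero
    have huz' : u - z * q ≠ 0 := by
      intro h; apply huz
      rw [sub_eq_zero.1 h, hzz]; field_simp; simp
    rw [hzq, sum_subset (range_mono (show s + 1 ≤ s + 2 + 1 by omega))] at ih
    swap
    · intro k _ hk
      rw [← hzq, qPoch_inv_pow_eq_zero hq (by simpa using hk)]
      simp
    have tel := sum_eq_mul_sum_of_telescope (n := s + 2 + 1)
      (f := fun k => qPoch z q k * qPoch (x * q * q) q k * qPoch u (q ^ 2) k /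
        (qPoch q q k * qPoch e (q ^ 2) k * qPoch u q k) * q ^ k)
      (g := fun k => qPoch (z * q * q) q k * qPoch x q k * qPoch u (q ^ 2) k /
        (qPoch q q k * qPoch e (q ^ 2) k * qPoch u q k) * q ^ k)
      -- Here `e = x z q³`, which is what makes the three coefficients of the certificate agree.
      (ρ := (1 - z * q) * (u - x * q) / ((1 - x * q) * (u - z * q)))
      (G := fun k => (x - z) * q / ((1 - x) * (1 - x * q) * (1 - z) * (u - z * q)) *
        ((1 - q ^ k) * (1 - u * q ^ k / q) * (1 - e * (q ^ k / q) ^ 2) *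
          (qPoch z q k * qPoch x q k * qPoch u (q ^ 2) k) /
          (qPoch q q k * qPoch e (q ^ 2) k * qPoch u q k)))
      ?_ (by simp) (by simp [hz, qPoch_inv_pow_eq_zero hq (Nat.lt_succ_self (s + 2))])
    · rw [hxq, tel, ih]
      by_cases hs : Even s
      · obtain ⟨p, rfl⟩ := hs
        have b1 := (he.mul_pow hq (p + p)).one_sub_ne_zero
        have b2 := he.sq_base.qPoch_ne_zero p
        have b3 : qPoch (u * q) (q ^ 2) p ≠ 0 := by
          have := (huf.mul_pow hq 1).sq_base.qPoch_ne_zero p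
          rwa [pow_one] at this
        have hE : Even (p + p + 2) := ⟨p + 1, by ring⟩
        have hE' : Even (p + p) := ⟨p, rfl⟩
        have d1 : (p + p) / 2 = p := by omega
        have d2 : (p + p + 2) / 2 = p + 1 := by omega
        rw [if_pos hE, if_pos hE', d1, d2]
        simp only [qPoch_succ]
        have hp : (q ^ 2) ^ p = q ^ (p + p) := by rw [← pow_mul]; congr 1; ring
        have b4 : 1 - u * q * q ^ (p + p) ≠ 0 := by
          convert huz using 1; ring
        have r : (1 - z * q) * (u - x * q) / ((1 - x * q) * (u - z * q)) =
            u * ((1 - q * q ^ (p + p)) * (1 - e / u * q ^ (p + p))) /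
              ((1 - e * q ^ (p + p)) * (1 - u * q * q ^ (p + p))) := by
          have : x * q = e * q ^ (p + p) := by rw [hx]; field_simp
          rw [this]
          have hzz' : z * q = 1 / (q * q ^ (p + p)) := by rw [hzz, pow_succ']; simp
          rw [hzz']
          rw [hzz'] at huz'
          have : u - 1 / (q * q ^ (p + p)) = - (1 - u * q * q ^ (p + p)) / (q * q ^ (p + p)) := by
            field_simp
            ring
          rw [this]
          have hQ0 : q ^ (p + p) ≠ 0 := pow_ne_zero _ hq
          generalize q ^ (p + p) = Q at *
          field_simp
          ring
        rw [r, hp]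
        generalize q ^ (p + p) = Q at *
        field_simp
        ring
      · have : ¬ Even (s + 2) := by simpa [Nat.even_add] using hs
        rw [if_neg hs, if_neg this, mul_zero]
    · intro k
      have m1 := hxf.one_sub_ne_zero
      have m2 := hxf1.one_sub_ne_zero
      have e1 : qPoch (z * q * q) q k =
          qPoch z q k * (1 - z * q ^ k) * (1 - z * q * q ^ k) / ((1 - z) * (1 - z * q)) := by
        rw [qPoch_mul_one_sub, mul_assoc (1 - _) (qPoch _ _ _), qPoch_mul_one_sub]; field_simp
      have e2 : qPoch (x * q * q) q k =
          qPoch x q k * (1 - x * q ^ k) * (1 - x * q * q ^ k) / ((1 - x) * (1 - x * q)) := by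
        rw [qPoch_mul_one_sub, mul_assoc (1 - _) (qPoch _ _ _), qPoch_mul_one_sub]; field_simp
      have n2 := (huf.mul_pow hq k).one_sub_ne_zero
      have n3 := qPoch_self_ne_zero h1 k
      have n4 := he.sq_base.qPoch_ne_zero k
      have n5 := huf.qPoch_ne_zero k
      have n6 : 1 - q * q ^ k ≠ 0 := by
        have := h1 k; rw [pow_succ'] at this; exact sub_ne_zero.2 this.symm
      have e4 : (q ^ 2) ^ k = (q ^ k) ^ 2 := by ring
      have n7 : 1 - e * (q ^ k) ^ 2 ≠ 0 := by
        rw [← pow_mul]; exact (he.mul_pow hq _).one_sub_ne_zero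
      simp only [qPoch_succ, e1, e2, e4]
      simp only [pow_succ _ k]
      generalize qPoch z q k = P1 at *
      generalize qPoch x q k = P2 at *
      generalize qPoch u (q ^ 2) k = P3 at *
      generalize qPoch q q k = P4 at *
      generalize qPoch e (q ^ 2) k = P5 at *
      generalize qPoch u q k = P6 at *
      generalize q ^ k = y at *
      have s1 : 1 - y * q = 1 - q * y := by ring
      have s2 : 1 - u * (y * q) / q = 1 - u * y := by field_simp
      have s3 : y * q / q = y := by field_simp
      rw [s1, s2, s3]
      clear_value x z
      clear ih hzq hqs hxq e1 e2 e4 hzz huz hz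
      generalize 1 - e * y ^ 2 = D1 at *
      generalize 1 - q * y = D2 at *
      generalize 1 - u * y = D3 at *
      rw [mul_comm z q] at *
      field_simp
      rw [hex]
      ring

/-! ### Sears' transformation -/

theorem sum_range_sum_range_eq (f : ℕ → ℕ → ℂ) (n : ℕ) :
    ∑ k ∈ range (n + 1), ∑ j ∈ range (k + 1), f k j =
      ∑ j ∈ range (n + 1), ∑ r ∈ range (n - j + 1), f (j + r) j := by
  rw [sum_comm' (t' := range (n + 1)) (s' := fun j => Ico j (n + 1))
    (by intro x y; simp only [mem_range, mem_Ico]; omega)]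
  refine sum_congr rfl fun j hj => ?_
  rw [sum_Ico_eq_sum_range, Nat.sub_add_comm (Nat.lt_succ_iff.1 (mem_range.1 hj))]

theorem qPoch_add_reverse (hq : q ≠ 0) {x : ℂ} (hx : x ≠ 0) (j r : ℕ) :
    qPoch x q (j + r) = qPoch x q r *
      (qPoch (q / (x * q ^ (j + r))) q j * ((-(x * q ^ r)) ^ j * q ^ j.choose 2)) := by
  rw [add_comm j r, qPoch_add, qPoch_reverse hq (mul_ne_zero hx (pow_ne_zero r hq)), mul_assoc x,
    ← pow_add]

theorem qPoch_self_add_reverse (hq : q ≠ 0) (j r : ℕ) :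
    qPoch q q (j + r) = qPoch q q r *
      (qPoch (q ^ (j + r))⁻¹ q j * ((-(q * q ^ r)) ^ j * q ^ j.choose 2)) := by
  rw [qPoch_add_reverse hq hq, show q / (q * q ^ (j + r)) = (q ^ (j + r))⁻¹ by field_simp]

/-- Interchange of the two summations in the proof of Sears' transformation: with `k = j + r` the
summand factors into a part depending on `j` and the summand of a `₃φ₂` series in `r`. `S` and `T`
stand for the two numerator products on which the computation does not depend. -/
theorem sears_term (hq : q ≠ 0) (h1 : ∀ k : ℕ, q ^ (k + 1) ≠ 1) {w A D E F g S T : ℂ}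
    (hg : g ≠ 0) (hD : QFree q D) (hE : QFree q E) (hF : QFree q F) (hgf : QFree q g) (j r : ℕ) :
    qPoch w q (j + r) * qPoch A q (j + r) /
        (qPoch q q (j + r) * qPoch E q (j + r) * qPoch F q (j + r)) * q ^ (j + r) *
      (qPoch g q (j + r) * (qPoch (q ^ (j + r))⁻¹ q j * S * T /
        (qPoch q q j * qPoch D q j * qPoch (q / (g * q ^ (j + r))) q j) * q ^ j)) =
    qPoch w q j * qPoch A q j * S * T /
        (qPoch q q j * qPoch D q j * qPoch E q j * qPoch F q j) * (g * q) ^ j *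
      (qPoch (w * q ^ j) q r * qPoch (A * q ^ j) q r * qPoch g q r /
        (qPoch q q r * qPoch (E * q ^ j) q r * qPoch (F * q ^ j) q r) * q ^ r) := by
  have e1 := qPoch_self_add_reverse hq j r
  have e2 := qPoch_add_reverse hq hg j r
  have n1 := qPoch_self_ne_zero h1 (j + r)
  have n2 := qPoch_self_ne_zero h1 j
  have n3 := qPoch_self_ne_zero h1 r
  have n4 := hE.qPoch_ne_zero j
  have n5 := (hE.mul_pow hq j).qPoch_ne_zero r
  have n6 := hF.qPoch_ne_zero j
  have n7 := (hF.mul_pow hq j).qPoch_ne_zero r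
  have n8 := hD.qPoch_ne_zero j
  have n9 : qPoch (q / (g * q ^ (j + r))) q j ≠ 0 := by
    have := (hgf.inv.mul_zpow hq (1 - (j + r : ℕ))).qPoch_ne_zero j
    rwa [zpow_sub₀ hq, zpow_one, zpow_natCast, inv_mul_eq_div, div_div, mul_comm _ g] at this
  have n10 : qPoch (q ^ (j + r))⁻¹ q j ≠ 0 := by
    intro h; rw [h] at e1; simp at e1; exact n1 e1
  rw [e1, e2]
  simp only [qPoch_add w q j r, qPoch_add A q j r, qPoch_add E q j r, qPoch_add F q j r,
    neg_pow (q * q ^ r), neg_pow (g * q ^ r), mul_pow]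
  have n11 : q ^ j.choose 2 ≠ 0 := pow_ne_zero _ hq
  have n12 : (q ^ r) ^ j ≠ 0 := pow_ne_zero _ (pow_ne_zero _ hq)
  have n13 : (-1 : ℂ) ^ j ≠ 0 := pow_ne_zero _ (by norm_num)
  have n14 : q ^ j ≠ 0 := pow_ne_zero _ hq
  generalize (q ^ r) ^ j = Y at *
  generalize q ^ j.choose 2 = Z at *
  generalize (-1 : ℂ) ^ j = U at *
  generalize qPoch (q / (g * q ^ (j + r))) q j = P1 at *
  generalize qPoch (q ^ (j + r))⁻¹ q j = P2 at *
  generalize qPoch (E * q ^ j) q r = P3 at *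
  generalize qPoch (F * q ^ j) q r = P4 at *
  generalize qPoch (A * q ^ j) q r = P5 at *
  generalize qPoch (w * q ^ j) q r = P6 at *
  rw [pow_add q j r]
  field_simp

/-- Sears' transformation of a terminating balanced `₄φ₃` series. The product `(B, C)_k / (D)_k` is
expanded by the `q`-Pfaff–Saalschütz sum, and after interchanging summations the inner sum is
evaluated by the same formula. -/
theorem sears (hq : q ≠ 0) (h1 : ∀ k : ℕ, q ^ (k + 1) ≠ 1) {A B C D E F : ℂ} (n : ℕ)
    (hbal : D * E * F * q ^ n = A * B * C * q) (hA : A ≠ 0) (hB : B ≠ 0) (hC : C ≠ 0)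
    (hD0 : D ≠ 0) (hE0 : E ≠ 0) (hF0 : F ≠ 0) (hD : QFree q D) (hE : QFree q E) (hF : QFree q F)
    (hg : QFree q (B * C / D)) (hAE : QFree q (A / E)) (hAF : QFree q (A / F)) :
    ∑ k ∈ range (n + 1), qPoch (q ^ n)⁻¹ q k * qPoch A q k * qPoch B q k * qPoch C q k /
        (qPoch q q k * qPoch D q k * qPoch E q k * qPoch F q k) * q ^ k =
      qPoch (E / A) q n * qPoch (A * q / (F * q ^ n)) q n /
          (qPoch E q n * qPoch (q / (F * q ^ n)) q n) *
        ∑ k ∈ range (n + 1), qPoch (q ^ n)⁻¹ q k * qPoch A q k * qPoch (D / B) q k *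
            qPoch (D / C) q k /
          (qPoch q q k * qPoch D q k * qPoch (A * q / (E * q ^ n)) q k *
            qPoch (A * q / (F * q ^ n)) q k) * q ^ k := by
  set g := B * C / D with hgd
  have hg0 : g ≠ 0 := by simp [hgd, hB, hC, hD0]
  set w := (q ^ n)⁻¹ with hw
  have hgw : F = A * g * q * w / E := by
    rw [hgd, hw]; field_simp; linear_combination hbal
  have step1 : ∀ k, qPoch w q k * qPoch A q k * qPoch B q k * qPoch C q k /
        (qPoch q q k * qPoch D q k * qPoch E q k * qPoch F q k) * q ^ k =
      ∑ j ∈ range (k + 1), qPoch w q k * qPoch A q k /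
        (qPoch q q k * qPoch E q k * qPoch F q k) * q ^ k *
      (qPoch g q k * (qPoch (q ^ k)⁻¹ q j * qPoch (D / B) q j * qPoch (D / C) q j /
        (qPoch q q j * qPoch D q j * qPoch (q / (g * q ^ k)) q j) * q ^ j)) := by
    intro k
    have s := qSaalschutz hq h1 (a := D / B) (b := D / C) (c := D) (div_ne_zero hD0 hB)
      (div_ne_zero hD0 hC) hD0 hD (by convert hg using 1; rw [hgd]; field_simp) k
    rw [show D / (D / B) = B by field_simp, show D / (D / C) = C by field_simp,
      show D / (D / B * (D / C)) = g by rw [hgd]; field_simp,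
      show D / B * (D / C) * q / (D * q ^ k) = q / (g * q ^ k) by rw [hgd]; field_simp] at s
    rw [← mul_sum, ← mul_sum, s]
    have := hg.qPoch_ne_zero k
    field_simp
  rw [sum_congr rfl fun k _ => step1 k, sum_range_sum_range_eq, mul_sum]
  refine sum_congr rfl fun j hj => ?_
  rw [sum_congr rfl fun r _ => sears_term hq h1 hg0 hD hE hF hg j r, ← mul_sum]
  obtain ⟨N, rfl⟩ := Nat.exists_eq_add_of_le (Nat.lt_succ_iff.1 (mem_range.1 hj))
  rw [Nat.add_sub_cancel_left]
  have hqN : q ^ N ≠ 0 := pow_ne_zero _ hq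
  have hqj : q ^ j ≠ 0 := pow_ne_zero _ hq
  have e0 : E * q ^ j / (A * q ^ j * g) = q / (F * q ^ (j + N)) := by
    rw [hgw, hw]; field_simp
  have hFi : QFree q (q / (F * q ^ (j + N))) := by
    have := hF.inv.mul_zpow hq (1 - (j + N : ℕ))
    rwa [zpow_sub₀ hq, zpow_one, zpow_natCast, inv_mul_eq_div, div_div, mul_comm _ F] at this
  have s := qSaalschutz hq h1 (a := A * q ^ j) (b := g) (c := E * q ^ j) (mul_ne_zero hA hqj)
      hg0 (mul_ne_zero hE0 hqj) (hE.mul_pow hq j) (by rw [e0]; exact hFi) N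
  rw [show (q ^ N)⁻¹ = w * q ^ j by rw [hw, pow_add]; field_simp, e0,
    show A * q ^ j * g * q / (E * q ^ j * q ^ N) = F * q ^ j by rw [hgw, hw, pow_add]; field_simp,
    show E * q ^ j / (A * q ^ j) = E / A by field_simp,
    show E * q ^ j / g = A * q / (F * q ^ (j + N)) * q ^ j by rw [hgw, hw]; field_simp] at s
  rw [s]
  have r1 := qPoch_add_reverse hq (div_ne_zero hE0 hA) j N
  have r2 := qPoch_add_reverse hq (x := q / (F * q ^ (j + N))) (by simp [hq, hF0]) j N
  rw [show q / (E / A * q ^ (j + N)) = A * q / (E * q ^ (j + N)) by field_simp] at r1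
  rw [show q / (q / (F * q ^ (j + N)) * q ^ (j + N)) = F by field_simp] at r2
  have hAEi : QFree q (A * q / (E * q ^ (j + N))) := by
    have := hAE.mul_zpow hq (1 - (j + N : ℕ))
    rwa [zpow_sub₀ hq, zpow_one, zpow_natCast, div_mul_div_comm] at this
  have hAFi : QFree q (A * q / (F * q ^ (j + N))) := by
    have := hAF.mul_zpow hq (1 - (j + N : ℕ))
    rwa [zpow_sub₀ hq, zpow_one, zpow_natCast, div_mul_div_comm] at this
  have n1 := qPoch_self_ne_zero h1 j
  have n2 := hD.qPoch_ne_zero j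
  have n3 := hE.qPoch_ne_zero j
  have n4 := (hE.mul_pow hq j).qPoch_ne_zero N
  have n5 := hF.qPoch_ne_zero j
  have n6 := hFi.qPoch_ne_zero N
  have n7 := hAEi.qPoch_ne_zero j
  have n8 := hAFi.qPoch_ne_zero j
  have e3 : (-(E / A * q ^ N)) ^ j = (-(q / (F * q ^ (j + N)) * q ^ N)) ^ j * g ^ j := by
    rw [← mul_pow]; congr 1; rw [hgw, hw]; field_simp
  rw [r1, r2, e3, qPoch_add E, qPoch_add (A * q / (F * q ^ (j + N))), mul_pow g q j]
  have n9 : (-(q / (F * q ^ (j + N)) * q ^ N)) ^ j * q ^ j.choose 2 ≠ 0 := by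
    simp [hq, hF0]
  generalize (-(q / (F * q ^ (j + N)) * q ^ N)) ^ j = Y at *
  generalize q ^ j.choose 2 = Z at *
  obtain ⟨n10, n11⟩ := mul_ne_zero_iff.1 n9
  generalize qPoch (A * q / (F * q ^ (j + N))) q j = P1 at *
  generalize qPoch (A * q / (F * q ^ (j + N)) * q ^ j) q N = P2 at *
  generalize qPoch (A * q / (E * q ^ (j + N))) q j = P3 at *
  generalize qPoch (q / (F * q ^ (j + N))) q N = P4 at *
  generalize qPoch (E * q ^ j) q N = P5 at *
  generalize qPoch (E / A) q N = P6 at *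
  generalize qPoch (D / B) q j = P7 at *
  generalize qPoch (D / C) q j = P8 at *
  field_simp

/-! ### The expansion in `q`-Watson series -/

theorem pow_pow_self_eq (q : ℂ) (j : ℕ) : (q ^ j) ^ j = q ^ j * (q ^ j.choose 2) ^ 2 := by
  have h : j * j = j + j.choose 2 * 2 := by
    rw [Nat.choose_two_right, Nat.div_two_mul_two_of_even (Nat.even_mul_pred_self j)]
    cases j
    · simp
    · simp only [Nat.add_sub_cancel]; ring
  rw [← pow_mul, ← pow_mul, ← pow_add, h]

theorem qPoch_inv_pow_mul (hq : q ≠ 0) (j r : ℕ) :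
    qPoch (q ^ (j + r))⁻¹ q j * qPoch q q r * (q ^ (j + r)) ^ j =
      qPoch q q (j + r) * ((-1) ^ j * q ^ j.choose 2) := by
  rw [qPoch_self_add_reverse hq j r, pow_add, mul_pow, pow_pow_self_eq, neg_pow (q * q ^ r),
    mul_pow]
  have : ((-1 : ℂ) ^ j) ^ 2 = 1 := by rw [← pow_mul, mul_comm, pow_mul]; simp
  linear_combination -(qPoch (q ^ j * q ^ r)⁻¹ q j * qPoch q q r * q ^ j * (q ^ r) ^ j *
    (q ^ j.choose 2) ^ 2) * this

/-- The very-well-poised factor turns `(x/q)_j (x q^j / q)_j` into `(x)_{2j}`. -/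
theorem wellPoised_factor (hq : q ≠ 0) {x : ℂ} (hx : QFree q x) (j : ℕ) :
    (1 - x / q * q ^ (2 * j)) / (1 - x / q) * qPoch (x / q) q j * qPoch (x / q * q ^ j) q j =
      qPoch x q (2 * j) := by
  have h0 : 1 - x / q ≠ 0 := by
    simpa [div_eq_mul_inv] using (hx.mul_zpow hq (-1)).one_sub_ne_zero
  have h := qPoch_mul_one_sub (x / q) q (2 * j)
  rw [div_mul_cancel₀ _ hq] at h
  have h' : qPoch (x / q) q (2 * j) = qPoch (x / q) q j * qPoch (x / q * q ^ j) q j := by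
    rw [two_mul, qPoch_add]
  rw [h'] at h
  rw [div_mul_eq_mul_div, div_mul_eq_mul_div, div_eq_iff h0]
  linear_combination h

/-- With `k = j + r`, the summand of the double sum obtained from `sixPhiFive` is a factor depending
on `j` times the summand of `qWatson` with the parameters `e q^{2j}` and `u q^{2j}`. -/
theorem quadratic_term (hq : q ≠ 0) (h1 : ∀ k : ℕ, q ^ (k + 1) ≠ 1) {w x c e u V W : ℂ}
    (he : QFree q e) (hu : QFree q u) (j r : ℕ) :
    qPoch w q (j + r) * qPoch x q (j + r) * qPoch u (q ^ 2) (j + r) /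
        (qPoch q q (j + r) * qPoch e (q ^ 2) (j + r) * qPoch u q (j + r)) * q ^ (j + r) *
      ((1 - u / q * q ^ (2 * j)) / (1 - u / q) *
        (qPoch (u / q) q j * V * qPoch (q ^ (j + r))⁻¹ q j /
          (qPoch q q j * W * qPoch (u * q ^ (j + r)) q j)) *
        (c * q ^ (j + r)) ^ j) =
    V * qPoch w q j * qPoch x q j * qPoch u (q ^ 2) j /
        (qPoch q q j * qPoch e (q ^ 2) j * W * qPoch (u / q * q ^ j) q j) *
        ((-1) ^ j * c ^ j * q ^ (j + 1).choose 2) *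
      (qPoch (w * q ^ j) q r * qPoch (x * q ^ j) q r * qPoch (u * q ^ (2 * j)) (q ^ 2) r /
        (qPoch q q r * qPoch (e * q ^ (2 * j)) (q ^ 2) r * qPoch (u * q ^ (2 * j)) q r) *
          q ^ r) := by
  have e1 := qPoch_inv_pow_mul hq j r
  have e2 := wellPoised_factor hq hu j
  have e3 : qPoch u q (j + r) * qPoch (u * q ^ (j + r)) q j =
      qPoch u q (2 * j) * qPoch (u * q ^ (2 * j)) q r := by
    rw [← qPoch_add, ← qPoch_add]; congr 1; ring
  have n1 := qPoch_self_ne_zero h1 (j + r)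
  have n2 := qPoch_self_ne_zero h1 j
  have n3 := qPoch_self_ne_zero h1 r
  have n4 := he.sq_base.qPoch_ne_zero j
  have n5 := (he.mul_pow hq (2 * j)).sq_base.qPoch_ne_zero r
  have n6 : qPoch (u / q * q ^ j) q j ≠ 0 := by
    have := ((hu.mul_zpow hq (-1)).mul_pow hq j).qPoch_ne_zero j
    rwa [zpow_neg_one, ← div_eq_mul_inv] at this
  have n7 := (hu.mul_pow hq (2 * j)).qPoch_ne_zero r
  have n8 := hu.qPoch_ne_zero (j + r)
  have n9 := (hu.mul_pow hq (j + r)).qPoch_ne_zero j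
  have n10 := hu.qPoch_ne_zero (2 * j)
  have e4 : (q ^ 2) ^ j = q ^ (2 * j) := by rw [← pow_mul]
  rw [qPoch_add w, qPoch_add x, qPoch_add u (q ^ 2), qPoch_add e (q ^ 2), e4, mul_pow c,
    Nat.choose_succ_succ' j 1, Nat.choose_one_right, pow_add q j (j.choose 2)]
  have e5 : qPoch (q ^ (j + r))⁻¹ q j * (q ^ (j + r)) ^ j / qPoch q q (j + r) =
      (-1) ^ j * q ^ j.choose 2 / qPoch q q r := by
    rw [div_eq_div_iff n1 n3]; linear_combination e1
  have e6 : (1 - u / q * q ^ (2 * j)) / (1 - u / q) * qPoch (u / q) q j /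
      (qPoch u q (j + r) * qPoch (u * q ^ (j + r)) q j) =
      1 / (qPoch (u / q * q ^ j) q j * qPoch (u * q ^ (2 * j)) q r) := by
    rw [e3, div_eq_div_iff (mul_ne_zero n10 n7) (mul_ne_zero n6 n7), ← e2]; ring
  rw [pow_add q j r] at *
  calc _ = qPoch w q j * qPoch (w * q ^ j) q r * (qPoch x q j * qPoch (x * q ^ j) q r) *
        (qPoch u (q ^ 2) j * qPoch (u * q ^ (2 * j)) (q ^ 2) r) * V * c ^ j * (q ^ j * q ^ r) /
        (qPoch e (q ^ 2) j * qPoch (e * q ^ (2 * j)) (q ^ 2) r * qPoch q q j * W) *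
        ((1 - u / q * q ^ (2 * j)) / (1 - u / q) * qPoch (u / q) q j /
          (qPoch u q (j + r) * qPoch (u * (q ^ j * q ^ r)) q j)) *
        (qPoch (q ^ j * q ^ r)⁻¹ q j * (q ^ j * q ^ r) ^ j / qPoch q q (j + r)) := by
        simp only [div_eq_mul_inv, mul_inv]; ring
    _ = _ := by
        rw [e5, e6]
        simp only [div_eq_mul_inv, mul_inv]; ring

theorem sum_range_eq_sum_range {f : ℕ → ℂ} {m s : ℕ} (hm : ∀ j, m < j → f j = 0)
    (hs : ∀ j, s < j → f j = 0) : ∑ j ∈ range (m + 1), f j = ∑ j ∈ range (s + 1), f j := by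
  rw [sum_subset (range_mono (show m + 1 ≤ s + m + 1 by omega))
      fun j _ hj => hm j (by simpa using hj),
    sum_subset (range_mono (show s + 1 ≤ s + m + 1 by omega))
      fun j _ hj => hs j (by simpa using hj)]

/-- A `₄φ₃` series which differs from the `q`-Watson series by the shift `q^m` is a sum of `m + 1`
closed forms: `(c)_k / (c² q^{-m})_k` is expanded by the `₆φ₅` sum in terms of `q`-Watson summands
of length `s - j`. -/
theorem quadratic_expansion (hq : q ≠ 0) (h1 : ∀ k : ℕ, q ^ (k + 1) ≠ 1) {e c : ℂ} (hc : c ≠ 0)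
    (he : QFree q e) (hcf : QFree q (c ^ 2)) (m s : ℕ) :
    ∑ k ∈ range (s + 1), qPoch (q ^ s)⁻¹ q k * qPoch (e * q ^ s / q) q k * qPoch c q k *
        qPoch (-(c / q ^ m)) q k /
        (qPoch q q k * qPoch e (q ^ 2) k * qPoch (c ^ 2 / q ^ m) q k) * q ^ k =
      ∑ j ∈ range (m + 1), if j ≤ s ∧ Even (s - j) then
        qPoch (q ^ m)⁻¹ q j * qPoch (q ^ s)⁻¹ q j * qPoch (e * q ^ s / q) q j *
            qPoch (c ^ 2 / q ^ (2 * m)) (q ^ 2) j /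
          (qPoch q q j * qPoch e (q ^ 2) j * qPoch (c ^ 2 / q ^ m) q j *
            qPoch (c ^ 2 / q ^ (2 * m) / q * q ^ j) q j) *
        ((-1) ^ j * c ^ j * q ^ (j + 1).choose 2) *
        ((c / q ^ m * q ^ j) ^ (s - j) *
          (qPoch q (q ^ 2) ((s - j) / 2) *
            qPoch (e / (c ^ 2 / q ^ (2 * m))) (q ^ 2) ((s - j) / 2)) /
          (qPoch (e * q ^ (2 * j)) (q ^ 2) ((s - j) / 2) *
            qPoch (c ^ 2 / q ^ (2 * m) * q ^ (2 * j) * q) (q ^ 2) ((s - j) / 2))) else 0 := by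
  set u := c ^ 2 / q ^ (2 * m) with hu
  have hqm : q ^ m ≠ 0 := pow_ne_zero _ hq
  have hu0 : u ≠ 0 := by simp [hu, hc, hq]
  have huf : QFree q u := by
    have := hcf.mul_zpow hq (-(2 * m : ℕ))
    rwa [zpow_neg, zpow_natCast, ← div_eq_mul_inv] at this
  have hcm : QFree q (c ^ 2 / q ^ m) := by
    have := hcf.mul_zpow hq (-m)
    rwa [zpow_neg, zpow_natCast, ← div_eq_mul_inv] at this
  have hδ : (c / q ^ m) ^ 2 = u := by rw [hu, div_pow]; congr 1; ring
  have hδf : QFree q (c / q ^ m) := QFree.of_sq (by rw [hδ]; exact huf)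
  have step1 : ∀ k, qPoch (q ^ s)⁻¹ q k * qPoch (e * q ^ s / q) q k * qPoch c q k *
        qPoch (-(c / q ^ m)) q k /
        (qPoch q q k * qPoch e (q ^ 2) k * qPoch (c ^ 2 / q ^ m) q k) * q ^ k =
      ∑ j ∈ range (k + 1), qPoch (q ^ s)⁻¹ q k * qPoch (e * q ^ s / q) q k * qPoch u (q ^ 2) k /
        (qPoch q q k * qPoch e (q ^ 2) k * qPoch u q k) * q ^ k *
      ((1 - u / q * q ^ (2 * j)) / (1 - u / q) *
        (qPoch (u / q) q j * qPoch (q ^ m)⁻¹ q j * qPoch (q ^ k)⁻¹ q j /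
          (qPoch q q j * qPoch (c ^ 2 / q ^ m) q j * qPoch (u * q ^ k) q j)) *
        (c * q ^ k) ^ j) := by
    intro k
    have hk := sixPhiFive hq h1 (b := (q ^ m)⁻¹) (δ := c / q ^ m) (inv_ne_zero hqm)
      (by rw [hδ]; exact huf)
      (by rw [hδ, hu]; convert hcm using 1; rw [two_mul, pow_add]; field_simp) k
    rw [hδ, show u / (q ^ m)⁻¹ = c ^ 2 / q ^ m by rw [hu, two_mul, pow_add]; field_simp,
      show c / q ^ m / (q ^ m)⁻¹ = c by field_simp,
      show c / q ^ m * q ^ k / (q ^ m)⁻¹ = c * q ^ k by field_simp] at hk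
    rw [← mul_sum, hk, ← hδ, ← qPoch_mul_neg, hδ]
    have n1 := huf.qPoch_ne_zero k
    have n2 := hδf.qPoch_ne_zero k
    generalize qPoch (c / q ^ m) q k = P1 at *
    generalize qPoch (-(c / q ^ m)) q k = P2 at *
    generalize qPoch (c ^ 2 / q ^ m) q k = P3 at *
    generalize qPoch (e * q ^ s / q) q k = P4 at *
    generalize qPoch (q ^ s)⁻¹ q k = P5 at *
    field_simp
  rw [sum_congr rfl fun k _ => step1 k, sum_range_sum_range_eq]
  rw [sum_range_eq_sum_range (m := m) (s := s)
    (fun j hj => by rw [qPoch_inv_pow_eq_zero hq hj]; simp)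
    (fun j hj => if_neg fun h => absurd h.1 (not_le.2 hj))]
  refine sum_congr rfl fun j hj => ?_
  rw [sum_congr rfl fun r _ => quadratic_term hq h1 he huf j r, ← mul_sum]
  have hjs : j ≤ s := Nat.lt_succ_iff.1 (mem_range.1 hj)
  have hqj : q ^ j ≠ 0 := pow_ne_zero _ hq
  have hW := qWatson hq h1 (e := e * q ^ (2 * j)) (u := u * q ^ (2 * j))
    (mul_ne_zero hu0 (pow_ne_zero _ hq)) (he.mul_pow hq _) (huf.mul_pow hq _) (s - j)
  have hsj : q ^ s = q ^ (s - j) * q ^ j := by rw [← pow_add, Nat.sub_add_cancel hjs]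
  rw [show (q ^ (s - j))⁻¹ = (q ^ s)⁻¹ * q ^ j by rw [hsj]; field_simp,
    show e * q ^ (2 * j) * q ^ (s - j) / q = e * q ^ s / q * q ^ j by
      rw [hsj, two_mul, pow_add]; ring,
    show e * q ^ (2 * j) / (u * q ^ (2 * j)) = e / u by field_simp] at hW
  rw [hW]
  by_cases hE : Even (s - j)
  · rw [if_pos hE, if_pos ⟨hjs, hE⟩]
    obtain ⟨p, hp⟩ := hE
    have hsq : (c / q ^ m * q ^ j) ^ 2 = u * q ^ (2 * j) := by
      rw [mul_pow, hδ, ← pow_mul q j, mul_comm j 2]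
    rw [hp, show (p + p) / 2 = p by omega, ← two_mul, pow_mul (c / q ^ m * q ^ j), hsq]
  · rw [if_neg hE, if_neg fun h => hE h.2, mul_zero]

/-! ### Switching a denominator parameter -/

theorem qPoch_mul_qPoch_comm (x q : ℂ) (i k : ℕ) :
    qPoch x q k * qPoch (x * q ^ k) q i = qPoch x q i * qPoch (x * q ^ i) q k := by
  rw [← qPoch_add, ← qPoch_add, add_comm]

/-- Moving the shift by `q^i` from one product to another:
`(v)_k (q/v)_i = (v q^{-i})_k (q^{1-k}/v)_i q^{ki}`. -/
theorem qPoch_shift (hq : q ≠ 0) {v : ℂ} (hv : v ≠ 0) (i k : ℕ) :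
    qPoch v q k * qPoch (q / v) q i =
      qPoch (v / q ^ i) q k * qPoch (q / (v * q ^ k)) q i * (q ^ k) ^ i := by
  have hqi : q ^ i ≠ 0 := pow_ne_zero _ hq
  have hqk : q ^ k ≠ 0 := pow_ne_zero _ hq
  have h := qPoch_mul_qPoch_comm (v / q ^ i) q i k
  rw [div_mul_cancel₀ v hqi, qPoch_reverse hq (x := v / q ^ i * q ^ k) (by simp [*]) i,
    qPoch_reverse hq (x := v / q ^ i) (by simp [*]) i, div_mul_cancel₀ v hqi,
    show v / q ^ i * q ^ k * q ^ i = v * q ^ k by field_simp,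
    show (-(v / q ^ i * q ^ k)) ^ i = (-(v / q ^ i)) ^ i * (q ^ k) ^ i by
      rw [← mul_pow]; congr 1; ring] at h
  have hne : (-(v / q ^ i)) ^ i * q ^ i.choose 2 ≠ 0 := by simp [*]
  refine mul_right_cancel₀ hne ?_
  linear_combination -h

theorem qPoch_div_pow (hq : q ≠ 0) {u : ℂ} (hu : u ≠ 0) (l n : ℕ) :
    qPoch (q / u) q l * qPoch u q n =
      qPoch (u / q ^ l) q n * qPoch (q / (u * q ^ n)) q l * (q ^ n) ^ l := by
  rw [← qPoch_shift hq hu, mul_comm]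

/-- For `k ≤ n` the quotient `(q^{1+l-n}/a²)_k / (-q^{1-n}/a)_k` is expanded by the `₆φ₅` sum of
length `n - k` so that the denominator parameter `-q^{1-n}/a` becomes `-q^{1+l-n}/a`, the negative
of the other one. -/
theorem base_switch_term (hq : q ≠ 0) (h1 : ∀ k : ℕ, q ^ (k + 1) ≠ 1) {a : ℂ} (ha : a ≠ 0)
    (haf : QFree q (a ^ 2)) (l k N : ℕ) :
    qPoch (q ^ (k + N))⁻¹ q k * qPoch (q * q ^ l * (q ^ (k + N))⁻¹ / a ^ 2) q k /
        qPoch (-(q * (q ^ (k + N))⁻¹ / a)) q k =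
      qPoch (a ^ 2 / q ^ l) q (k + N) * qPoch (-(a / q ^ l)) q (k + N) /
          (qPoch (a ^ 2 / q ^ (2 * l)) q (k + N) * qPoch (-a) q (k + N)) *
        ∑ i ∈ range (l + 1), (1 - a ^ 2 / q ^ (2 * l) / q * q ^ (2 * i)) /
            (1 - a ^ 2 / q ^ (2 * l) / q) *
          (qPoch (a ^ 2 / q ^ (2 * l) / q) q i * qPoch (q ^ l)⁻¹ q i * qPoch (q ^ (k + N))⁻¹ q i /
            (qPoch q q i * qPoch (a ^ 2 / q ^ l) q i *
              qPoch (a ^ 2 / q ^ (2 * l) * q ^ (k + N)) q i)) *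
          (-a * q ^ (k + N)) ^ i *
          (qPoch ((q ^ (k + N))⁻¹ * q ^ i) q k *
            qPoch (q * q ^ (2 * l) * (q ^ (k + N))⁻¹ / a ^ 2 / q ^ i) q k /
              qPoch (-(q * q ^ l * (q ^ (k + N))⁻¹ / a)) q k) := by
  set n := k + N with hn
  have hql : q ^ l ≠ 0 := pow_ne_zero _ hq
  have hqn : q ^ n ≠ 0 := pow_ne_zero _ hq
  have hqk : q ^ k ≠ 0 := pow_ne_zero _ hq
  have hqN : q ^ N ≠ 0 := pow_ne_zero _ hq
  have hnkN : q ^ n = q ^ k * q ^ N := by rw [hn, pow_add]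
  have h2l : q ^ (2 * l) = (q ^ l) ^ 2 := by rw [mul_comm, pow_mul]
  have hal : QFree q (a ^ 2 / q ^ l) := by
    have := haf.mul_zpow hq (-l)
    rwa [zpow_neg, zpow_natCast, ← div_eq_mul_inv] at this
  have ha2l : QFree q (a ^ 2 / q ^ (2 * l)) := by
    have := haf.mul_zpow hq (-(2 * l : ℕ))
    rwa [zpow_neg, zpow_natCast, ← div_eq_mul_inv] at this
  have hma : QFree q (-a) := QFree.of_sq (by rwa [neg_sq])
  have hmal : QFree q (-(a / q ^ l)) := QFree.of_sq (by rwa [neg_sq, div_pow, ← h2l])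
  have hsum := sixPhiFive hq h1 (b := (q ^ l)⁻¹) (δ := -(a / q ^ l)) (inv_ne_zero hql)
    (by rwa [neg_sq, div_pow, ← h2l])
    (by rw [neg_sq, div_pow]; convert hal using 1; field_simp) N
  rw [neg_sq, div_pow, ← h2l, show a ^ 2 / q ^ (2 * l) / (q ^ l)⁻¹ = a ^ 2 / q ^ l by
      rw [h2l]; field_simp,
    show -(a / q ^ l) / (q ^ l)⁻¹ = -a by field_simp,
    show -(a / q ^ l) * q ^ N / (q ^ l)⁻¹ = -a * q ^ N by field_simp] at hsum
  rw [← sum_range_eq_sum_range (m := l) (s := N)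
    (fun j hj => by rw [qPoch_inv_pow_eq_zero hq hj]; simp)
    (fun j hj => by rw [qPoch_inv_pow_eq_zero hq hj]; simp)] at hsum
  set v := q * q ^ (2 * l) * (q ^ n)⁻¹ / a ^ 2 with hv
  have hv0 : v ≠ 0 := by simp [hv, hq, ha]
  have term : ∀ i, qPoch v q k * qPoch (q ^ n)⁻¹ q k *
      ((1 - a ^ 2 / q ^ (2 * l) / q * q ^ (2 * i)) / (1 - a ^ 2 / q ^ (2 * l) / q) *
        (qPoch (a ^ 2 / q ^ (2 * l) / q) q i * qPoch (q ^ l)⁻¹ q i * qPoch (q ^ N)⁻¹ q i /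
          (qPoch q q i * qPoch (a ^ 2 / q ^ l) q i * qPoch (a ^ 2 / q ^ (2 * l) * q ^ N) q i)) *
        (-a * q ^ N) ^ i) =
      (1 - a ^ 2 / q ^ (2 * l) / q * q ^ (2 * i)) / (1 - a ^ 2 / q ^ (2 * l) / q) *
          (qPoch (a ^ 2 / q ^ (2 * l) / q) q i * qPoch (q ^ l)⁻¹ q i * qPoch (q ^ n)⁻¹ q i /
            (qPoch q q i * qPoch (a ^ 2 / q ^ l) q i * qPoch (a ^ 2 / q ^ (2 * l) * q ^ n) q i)) *
          (-a * q ^ n) ^ i * (qPoch ((q ^ n)⁻¹ * q ^ i) q k * qPoch (v / q ^ i) q k) := by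
    intro i
    have t1 := qPoch_mul_qPoch_comm (q ^ n)⁻¹ q i k
    have t2 := qPoch_shift hq hv0 i k
    rw [show (q ^ n)⁻¹ * q ^ k = (q ^ N)⁻¹ by rw [hnkN]; field_simp] at t1
    rw [show q / v = a ^ 2 / q ^ (2 * l) * q ^ n by rw [hv]; field_simp,
      show q / (v * q ^ k) = a ^ 2 / q ^ (2 * l) * q ^ N by rw [hv, hnkN]; field_simp] at t2
    have t3 : (-a * q ^ n) ^ i = (-a * q ^ N) ^ i * (q ^ k) ^ i := by
      rw [← mul_pow, hnkN]; congr 1; ring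
    have n1 := (ha2l.mul_pow hq n).qPoch_ne_zero i
    have n2 := (ha2l.mul_pow hq N).qPoch_ne_zero i
    have n3 := qPoch_self_ne_zero h1 i
    have n4 := hal.qPoch_ne_zero i
    have t4 : qPoch v q k / qPoch (a ^ 2 / q ^ (2 * l) * q ^ N) q i =
        qPoch (v / q ^ i) q k * (q ^ k) ^ i / qPoch (a ^ 2 / q ^ (2 * l) * q ^ n) q i := by
      rw [div_eq_div_iff n2 n1, t2]; ring
    rw [t3]
    calc _ = (1 - a ^ 2 / q ^ (2 * l) / q * q ^ (2 * i)) / (1 - a ^ 2 / q ^ (2 * l) / q) *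
          (qPoch (a ^ 2 / q ^ (2 * l) / q) q i * qPoch (q ^ l)⁻¹ q i /
            (qPoch q q i * qPoch (a ^ 2 / q ^ l) q i)) * (-a * q ^ N) ^ i *
          (qPoch (q ^ n)⁻¹ q k * qPoch (q ^ N)⁻¹ q i) *
          (qPoch v q k / qPoch (a ^ 2 / q ^ (2 * l) * q ^ N) q i) := by
          simp only [div_eq_mul_inv, mul_inv]; ring
      _ = _ := by
          rw [t1, t4]
          simp only [div_eq_mul_inv, mul_inv]; ring
  have pull : ∀ S : ℕ → ℂ, (∑ i ∈ range (l + 1), S i * (qPoch ((q ^ n)⁻¹ * q ^ i) q k *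
      qPoch (v / q ^ i) q k / qPoch (-(q * q ^ l * (q ^ n)⁻¹ / a)) q k)) =
      (∑ i ∈ range (l + 1), S i * (qPoch ((q ^ n)⁻¹ * q ^ i) q k * qPoch (v / q ^ i) q k)) /
        qPoch (-(q * q ^ l * (q ^ n)⁻¹ / a)) q k := by
    intro S
    rw [sum_div]
    exact sum_congr rfl fun i _ => (mul_div_assoc _ _ _).symm
  rw [pull, ← sum_congr rfl fun i _ => term i, ← mul_sum, hsum]
  have r1 := qPoch_add_reverse hq (x := a ^ 2 / q ^ (2 * l)) (by simp [ha, hq]) k N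
  have r2 := qPoch_add_reverse hq (x := -a) (by simp [ha]) k N
  have r3 := qPoch_add_reverse hq (x := a ^ 2 / q ^ l) (by simp [ha, hq]) k N
  have r4 := qPoch_add_reverse hq (x := -(a / q ^ l)) (by simp [ha, hq]) k N
  rw [← hn] at r1 r2 r3 r4
  rw [show q / (a ^ 2 / q ^ (2 * l) * q ^ n) = v by rw [hv]; field_simp] at r1
  rw [show q / (-a * q ^ n) = -(q * (q ^ n)⁻¹ / a) by field_simp] at r2
  rw [show q / (a ^ 2 / q ^ l * q ^ n) = q * q ^ l * (q ^ n)⁻¹ / a ^ 2 by field_simp] at r3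
  rw [show q / (-(a / q ^ l) * q ^ n) = -(q * q ^ l * (q ^ n)⁻¹ / a) by field_simp] at r4
  have hpow : (-(a ^ 2 / q ^ (2 * l) * q ^ N)) ^ k * (-(-a * q ^ N)) ^ k =
      (-(a ^ 2 / q ^ l * q ^ N)) ^ k * (-(-(a / q ^ l) * q ^ N)) ^ k := by
    rw [← mul_pow, ← mul_pow, h2l]; congr 1; field_simp
  have m1 := ha2l.qPoch_ne_zero n
  have m2 := hma.qPoch_ne_zero n
  have m3 := hal.qPoch_ne_zero n
  have m4 := hmal.qPoch_ne_zero n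
  rw [r1] at m1 ⊢
  rw [r2] at m2 ⊢
  rw [r3] at m3 ⊢
  rw [r4] at m4 ⊢
  simp only [mul_ne_zero_iff] at m1 m2 m3 m4
  obtain ⟨m11, m12, m13, m14⟩ := m1
  obtain ⟨m21, m22, m23, -⟩ := m2
  obtain ⟨m31, m32, m33, -⟩ := m3
  obtain ⟨m41, m42, m43, -⟩ := m4
  clear_value v
  clear term pull hsum r1 r2 r3 r4
  generalize (-(a ^ 2 / q ^ (2 * l) * q ^ N)) ^ k = Z1 at *
  generalize (-(-a * q ^ N)) ^ k = Z2 at *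
  generalize (-(a ^ 2 / q ^ l * q ^ N)) ^ k = Z3 at *
  generalize (-(-(a / q ^ l) * q ^ N)) ^ k = Z4 at *
  generalize q ^ k.choose 2 = Z5 at *
  generalize qPoch (q ^ n)⁻¹ q k = P0 at *
  generalize qPoch v q k = P1 at *
  generalize qPoch (-(q * (q ^ n)⁻¹ / a)) q k = P2 at *
  generalize qPoch (q * q ^ l * (q ^ n)⁻¹ / a ^ 2) q k = P3 at *
  generalize qPoch (-(q * q ^ l * (q ^ n)⁻¹ / a)) q k = P4 at *
  generalize qPoch (a ^ 2 / q ^ (2 * l)) q N = P5 at *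
  generalize qPoch (-a) q N = P6 at *
  generalize qPoch (a ^ 2 / q ^ l) q N = P7 at *
  generalize qPoch (-(a / q ^ l)) q N = P8 at *
  field_simp
  linear_combination P0 * hpow

/-- Summed form of `base_switch_term`, with an arbitrary remaining factor `R k`. -/
theorem base_switch (hq : q ≠ 0) (h1 : ∀ k : ℕ, q ^ (k + 1) ≠ 1) {a : ℂ} (ha : a ≠ 0)
    (haf : QFree q (a ^ 2)) (l n : ℕ) (R : ℕ → ℂ) :
    ∑ k ∈ range (n + 1), qPoch (q ^ n)⁻¹ q k * qPoch (q * q ^ l * (q ^ n)⁻¹ / a ^ 2) q k /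
        (qPoch (q * q ^ l * (q ^ n)⁻¹ / a) q k * qPoch (-(q * (q ^ n)⁻¹ / a)) q k) * R k =
      qPoch (a ^ 2 / q ^ l) q n * qPoch (-(a / q ^ l)) q n /
          (qPoch (a ^ 2 / q ^ (2 * l)) q n * qPoch (-a) q n) *
        ∑ i ∈ range (l + 1), if i ≤ n then
          (1 - a ^ 2 / q ^ (2 * l) / q * q ^ (2 * i)) / (1 - a ^ 2 / q ^ (2 * l) / q) *
          (qPoch (a ^ 2 / q ^ (2 * l) / q) q i * qPoch (q ^ l)⁻¹ q i * qPoch (q ^ n)⁻¹ q i /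
            (qPoch q q i * qPoch (a ^ 2 / q ^ l) q i *
              qPoch (a ^ 2 / q ^ (2 * l) * q ^ n) q i)) *
          (-a * q ^ n) ^ i *
          ∑ k ∈ range (n - i + 1), qPoch (q ^ (n - i))⁻¹ q k *
            qPoch (q * q ^ (2 * l) * (q ^ n)⁻¹ / a ^ 2 / q ^ i) q k /
              qPoch ((q * q ^ l * (q ^ n)⁻¹ / a) ^ 2) (q ^ 2) k * R k else 0 := by
  have step : ∀ k ∈ range (n + 1), qPoch (q ^ n)⁻¹ q k *
        qPoch (q * q ^ l * (q ^ n)⁻¹ / a ^ 2) q k /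
        (qPoch (q * q ^ l * (q ^ n)⁻¹ / a) q k * qPoch (-(q * (q ^ n)⁻¹ / a)) q k) * R k =
      qPoch (a ^ 2 / q ^ l) q n * qPoch (-(a / q ^ l)) q n /
          (qPoch (a ^ 2 / q ^ (2 * l)) q n * qPoch (-a) q n) *
        ∑ i ∈ range (l + 1), (1 - a ^ 2 / q ^ (2 * l) / q * q ^ (2 * i)) /
            (1 - a ^ 2 / q ^ (2 * l) / q) *
          (qPoch (a ^ 2 / q ^ (2 * l) / q) q i * qPoch (q ^ l)⁻¹ q i * qPoch (q ^ n)⁻¹ q i /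
            (qPoch q q i * qPoch (a ^ 2 / q ^ l) q i *
              qPoch (a ^ 2 / q ^ (2 * l) * q ^ n) q i)) *
          (-a * q ^ n) ^ i * (qPoch ((q ^ n)⁻¹ * q ^ i) q k *
            qPoch (q * q ^ (2 * l) * (q ^ n)⁻¹ / a ^ 2 / q ^ i) q k /
              qPoch ((q * q ^ l * (q ^ n)⁻¹ / a) ^ 2) (q ^ 2) k * R k) := by
    intro k hk
    obtain ⟨N, rfl⟩ := Nat.exists_eq_add_of_le (Nat.lt_succ_iff.1 (mem_range.1 hk))
    have h := base_switch_term hq h1 ha haf l k N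
    rw [← qPoch_mul_neg, mul_comm (qPoch (q * q ^ l * (q ^ (k + N))⁻¹ / a) q k), ← div_div, h,
      mul_div_assoc, sum_div, mul_assoc, sum_mul]
    congr 1
    refine sum_congr rfl fun i _ => ?_
    simp only [div_eq_mul_inv, mul_inv]; ring
  rw [sum_congr rfl step, ← mul_sum, sum_comm]
  congr 1
  refine sum_congr rfl fun i _ => ?_
  rw [← mul_sum]
  split_ifs with hi
  · have hni : (q ^ n)⁻¹ * q ^ i = (q ^ (n - i))⁻¹ := by
      have : q ^ n = q ^ (n - i) * q ^ i := by rw [← pow_add, Nat.sub_add_cancel hi]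
      have := pow_ne_zero i hq
      rw [‹q ^ n = _›]; field_simp
    rw [hni]
    congr 1
    refine (sum_subset (range_mono (by omega)) fun k _ hk => ?_).symm
    rw [qPoch_inv_pow_eq_zero hq (n := n - i) (k := k) (by simp at hk; omega)]
    simp
  · rw [qPoch_inv_pow_eq_zero hq (not_le.1 hi)]
    simp

/-- The constant produced by `base_switch` consists of products of order `n`; it equals a quotient
of products of order `l`. -/
theorem prefactor_eq (hq : q ≠ 0) {a : ℂ} (ha : a ≠ 0) (haf : QFree q (a ^ 2)) (l n : ℕ) :
    qPoch (a ^ 2 / q ^ l) q n * qPoch (-(a / q ^ l)) q n /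
          (qPoch (a ^ 2 / q ^ (2 * l)) q n * qPoch (-a) q n) =
      qPoch (q * q ^ l * (q ^ n)⁻¹ / a ^ 2) q l * qPoch (-q / a) q l /
        (qPoch (q * q ^ l / a ^ 2) q l * qPoch (-(q * (q ^ n)⁻¹) / a) q l) := by
  have hql : q ^ l ≠ 0 := pow_ne_zero _ hq
  have hqn : q ^ n ≠ 0 := pow_ne_zero _ hq
  have h2l : q ^ (2 * l) = (q ^ l) ^ 2 := by rw [mul_comm, pow_mul]
  have t1 := qPoch_div_pow hq (u := -a) (by simp [ha]) l n
  have t2 := qPoch_div_pow hq (u := a ^ 2 / q ^ l) (by simp [ha, hq]) l n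
  have ha2l : QFree q (a ^ 2 / q ^ (2 * l)) := by
    have := haf.mul_zpow hq (-(2 * l : ℕ))
    rwa [zpow_neg, zpow_natCast, ← div_eq_mul_inv] at this
  have hma : QFree q (-a) := QFree.of_sq (by rwa [neg_sq])
  have f1 : QFree q (q * q ^ l / a ^ 2) := by
    have := haf.inv.mul_zpow hq (1 + l)
    rw [zpow_add₀ hq, zpow_one, zpow_natCast] at this
    convert this using 1
    field_simp
  have f2 : QFree q (-(q * (q ^ n)⁻¹) / a) := by
    have := hma.inv.mul_zpow hq (1 - n)
    rw [zpow_sub₀ hq, zpow_one, zpow_natCast] at this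
    convert this using 1
    field_simp
  rw [show q / -a = -q / a by field_simp, show -a / q ^ l = -(a / q ^ l) by ring,
    show q / (-a * q ^ n) = -(q * (q ^ n)⁻¹) / a by field_simp] at t1
  rw [show q / (a ^ 2 / q ^ l) = q * q ^ l / a ^ 2 by field_simp,
    show a ^ 2 / q ^ l / q ^ l = a ^ 2 / q ^ (2 * l) by rw [h2l]; field_simp,
    show q / (a ^ 2 / q ^ l * q ^ n) = q * q ^ l * (q ^ n)⁻¹ / a ^ 2 by field_simp] at t2
  have hp : (q ^ n) ^ l ≠ 0 := pow_ne_zero _ hqn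
  rw [div_eq_div_iff (mul_ne_zero (ha2l.qPoch_ne_zero n) (hma.qPoch_ne_zero n))
    (mul_ne_zero (f1.qPoch_ne_zero l) (f2.qPoch_ne_zero l))]
  refine mul_right_cancel₀ hp ?_
  linear_combination qPoch (-(a / q ^ l)) q n * qPoch (-(q * (q ^ n)⁻¹) / a) q l * (q ^ n) ^ l * t2
    - qPoch (a ^ 2 / q ^ (2 * l)) q n * qPoch (q * q ^ l * (q ^ n)⁻¹ / a ^ 2) q l *
      (q ^ n) ^ l * t1

/-! ### The identity for generic parameters -/

/-- The `₄φ₃` series on the left, truncated to the terms `k ≤ n`. -/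
noncomputable def lhsSum (n l m : ℕ) (q a c : ℂ) : ℂ :=
  ∑ k ∈ range (n + 1),
    qFrac q [q ^ (-n : ℤ), a, c, -q ^ (1 + l + m - n : ℤ) / (a * c)]
      (q :: [q ^ (1 + l - n : ℤ) / a, q ^ (1 + m - n : ℤ) / c, -(a * c)]) k * q ^ k

/-- The summand with indices `i`, `j` of the double sum on the right. -/
noncomputable def rhsTerm (n l m i j : ℕ) (q a c : ℂ) : ℂ :=
  (-1) ^ (i + j) *
          q ^ ((n * i + (n - i - j) * (j - m) + ((j + 1).choose 2 : ℕ) : ℤ)) *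
          a ^ i * c ^ (n - i : ℤ) *
          ((1 - q ^ (2 * i - 2 * l - 1 : ℤ) * a ^ 2) / (1 - q ^ (-2 * l - 1 : ℤ) * a ^ 2)) *
          qFrac q [q ^ (-l : ℤ), q ^ (-n : ℤ), q ^ (-2 * l - 1 : ℤ) * a ^ 2]
            [q, q ^ (n - 2 * l : ℤ) * a ^ 2, q ^ (-l : ℤ) * a ^ 2] i *
          qFrac q [q ^ (-m : ℤ), q ^ (i - n : ℤ), q ^ (1 + 2 * l - n - i : ℤ) / a ^ 2,
              q ^ (-m : ℤ) * c, -q ^ (-m : ℤ) * c]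
            [q, q ^ (1 + l - n : ℤ) / a, -q ^ (1 + l - n : ℤ) / a,
              q ^ (-m : ℤ) * c ^ 2, q ^ (j - 2 * m - 1 : ℤ) * c ^ 2] j *
          qFrac (q ^ 2) [q, q ^ (2 + 2 * l + 2 * m - 2 * n : ℤ) / (a ^ 2 * c ^ 2)]
            [q ^ (2 + 2 * l - 2 * n + 2 * j : ℤ) / a ^ 2, q ^ (1 - 2 * m + 2 * j : ℤ) * c ^ 2]
            ((n - i - j) / 2) *
          parityChi (n - i - j)

/-- The product in front of the double sum. -/
noncomputable def prefactor (n l m : ℕ) (q a c : ℂ) : ℂ :=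
  qFrac q [q ^ (1 + l - n : ℤ) / a ^ 2, -q / a]
          [q ^ (1 + l : ℤ) / a ^ 2, -q ^ (1 - n : ℤ) / a] l *
        qFrac q [-a, q ^ (-m : ℤ) * c ^ 2] [-(a * c), q ^ (-m : ℤ) * c] n

/-- The right-hand side, with the summands that carry a zero factor replaced by `0`: in those the
denominators are not under control. -/
noncomputable def rhsSum (n l m : ℕ) (q a c : ℂ) : ℂ :=
  prefactor n l m q a c * ∑ i ∈ range (l + 1), ∑ j ∈ range (m + 1),
    if i + j ≤ n ∧ Even (n - i - j) then rhsTerm n l m i j q a c else 0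

theorem parityChi_of_even {n i j : ℕ} (h : i + j ≤ n) (hE : Even (n - i - j)) :
    parityChi (n - i - j) = 1 := by
  have : (n - i - j : ℤ) = ((n - i - j : ℕ) : ℤ) := by omega
  rw [parityChi, this, zpow_natCast, hE.neg_one_pow]
  norm_num

theorem rhsTerm_eq (hq : q ≠ 0) {a c : ℂ} (ha : a ≠ 0) (hc : c ≠ 0) {n l m i j : ℕ}
    (h : i + j ≤ n) (hE : Even (n - i - j)) :
    rhsTerm n l m i j q a c =
      (1 - a ^ 2 / q ^ (2 * l) / q * q ^ (2 * i)) / (1 - a ^ 2 / q ^ (2 * l) / q) *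
          (qPoch (a ^ 2 / q ^ (2 * l) / q) q i * qPoch (q ^ l)⁻¹ q i * qPoch (q ^ n)⁻¹ q i /
            (qPoch q q i * qPoch (a ^ 2 / q ^ l) q i *
              qPoch (a ^ 2 / q ^ (2 * l) * q ^ n) q i)) *
          (-a * q ^ n) ^ i *
        (qPoch (q ^ m)⁻¹ q j * qPoch (q ^ (n - i))⁻¹ q j *
            qPoch ((q * q ^ l * (q ^ n)⁻¹ / a) ^ 2 * q ^ (n - i) / q) q j *
            qPoch (c ^ 2 / q ^ (2 * m)) (q ^ 2) j /
          (qPoch q q j * qPoch ((q * q ^ l * (q ^ n)⁻¹ / a) ^ 2) (q ^ 2) j *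
            qPoch (c ^ 2 / q ^ m) q j * qPoch (c ^ 2 / q ^ (2 * m) / q * q ^ j) q j) *
        ((-1) ^ j * c ^ j * q ^ (j + 1).choose 2) *
        ((c / q ^ m * q ^ j) ^ (n - i - j) *
          (qPoch q (q ^ 2) ((n - i - j) / 2) *
            qPoch ((q * q ^ l * (q ^ n)⁻¹ / a) ^ 2 / (c ^ 2 / q ^ (2 * m))) (q ^ 2)
              ((n - i - j) / 2)) /
          (qPoch ((q * q ^ l * (q ^ n)⁻¹ / a) ^ 2 * q ^ (2 * j)) (q ^ 2) ((n - i - j) / 2) *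
            qPoch (c ^ 2 / q ^ (2 * m) * q ^ (2 * j) * q) (q ^ 2) ((n - i - j) / 2)))) := by
  rw [rhsTerm, parityChi_of_even h hE, mul_one]
  clear hE
  have hC : q ^ ((n * i + (n - i - j) * (j - m) + ((j + 1).choose 2 : ℕ) : ℤ)) * c ^ (n - i : ℤ) =
      (q ^ n) ^ i * (c ^ j * q ^ (j + 1).choose 2) * (c / q ^ m * q ^ j) ^ (n - i - j) := by
    have e1 : (n - i - j : ℤ) = ((n - i - j : ℕ) : ℤ) := by omega
    have e2 : (n - i : ℤ) = ((j + (n - i - j) : ℕ) : ℤ) := by omega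
    rw [zpow_add₀ hq, zpow_add₀ hq, zpow_mul, e1, mul_comm _ (j - m : ℤ), zpow_mul, e2,
      zpow_sub₀ hq]
    simp only [zpow_natCast, pow_add c, mul_pow, div_pow]
    ring
  obtain ⟨p, rfl⟩ := Nat.exists_eq_add_of_le h
  rw [show i + j + p - i = j + p by omega] at *
  have hqm : q ^ m ≠ 0 := pow_ne_zero _ hq
  have hql : q ^ l ≠ 0 := pow_ne_zero _ hq
  have hqi : q ^ i ≠ 0 := pow_ne_zero _ hq
  have hqj : q ^ j ≠ 0 := pow_ne_zero _ hq
  have hqp : q ^ p ≠ 0 := pow_ne_zero _ hq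
  have a1 : q ^ (2 * i - 2 * l - 1 : ℤ) * a ^ 2 = a ^ 2 / q ^ (2 * l) / q * q ^ (2 * i) := by
    simp only [zpow_add₀ hq, zpow_sub₀ hq, zpow_natCast, zpow_one, two_mul, pow_add]
    field_simp
  have a2 : q ^ (-2 * l - 1 : ℤ) * a ^ 2 = a ^ 2 / q ^ (2 * l) / q := by
    simp only [neg_mul, zpow_neg, zpow_add₀ hq, zpow_sub₀ hq, zpow_natCast, zpow_one, two_mul,
      pow_add]
    field_simp
  have a3 (r : ℕ) : q ^ (-r : ℤ) = (q ^ r)⁻¹ := by rw [zpow_neg, zpow_natCast]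
  have a4 : q ^ ((i + j + p : ℕ) - 2 * l : ℤ) * a ^ 2 =
      a ^ 2 / q ^ (2 * l) * q ^ (i + j + p) := by
    simp only [zpow_add₀ hq, zpow_sub₀ hq, zpow_natCast, two_mul, pow_add]
    field_simp
  have a5 : q ^ (-l : ℤ) * a ^ 2 = a ^ 2 / q ^ l := by rw [a3]; field_simp
  have a6 : q ^ (i - (i + j + p : ℕ) : ℤ) = (q ^ (j + p))⁻¹ := by
    rw [← a3]; congr 1; push_cast; ring
  have a7 : q ^ (1 + 2 * l - (i + j + p : ℕ) - i : ℤ) / a ^ 2 =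
      (q * q ^ l * (q ^ (i + j + p))⁻¹ / a) ^ 2 * q ^ (j + p) / q := by
    simp only [zpow_add₀ hq, zpow_sub₀ hq, zpow_natCast, zpow_one, two_mul, pow_add]
    field_simp
  have a8 : qPoch (c ^ 2 / q ^ (2 * m)) (q ^ 2) j =
      qPoch (q ^ (-m : ℤ) * c) q j * qPoch (-q ^ (-m : ℤ) * c) q j := by
    rw [neg_mul, qPoch_mul_neg, a3, mul_comm 2 m, pow_mul]
    congr 1; field_simp
  have a9 : q ^ (1 + l - (i + j + p : ℕ) : ℤ) / a = q * q ^ l * (q ^ (i + j + p))⁻¹ / a := by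
    rw [zpow_sub₀ hq, zpow_add₀ hq, zpow_natCast, zpow_natCast, zpow_one,
      div_eq_mul_inv (q * q ^ l)]
  have a10 : -q ^ (1 + l - (i + j + p : ℕ) : ℤ) / a =
      -(q * q ^ l * (q ^ (i + j + p))⁻¹ / a) := by
    rw [neg_div, a9]
  have a11 : q ^ (-m : ℤ) * c ^ 2 = c ^ 2 / q ^ m := by rw [a3]; field_simp
  have a12 : q ^ (j - 2 * m - 1 : ℤ) * c ^ 2 = c ^ 2 / q ^ (2 * m) / q * q ^ j := by
    simp only [zpow_add₀ hq, zpow_sub₀ hq, zpow_natCast, zpow_one, two_mul, pow_add]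
    field_simp
  have a13 : q ^ (2 + 2 * l + 2 * m - 2 * (i + j + p : ℕ) : ℤ) / (a ^ 2 * c ^ 2) =
      (q * q ^ l * (q ^ (i + j + p))⁻¹ / a) ^ 2 / (c ^ 2 / q ^ (2 * m)) := by
    simp only [zpow_add₀ hq, zpow_sub₀ hq, zpow_natCast, two_mul, pow_add, zpow_ofNat]
    field_simp
  have a14 : q ^ (2 + 2 * l - 2 * (i + j + p : ℕ) + 2 * j : ℤ) / a ^ 2 =
      (q * q ^ l * (q ^ (i + j + p))⁻¹ / a) ^ 2 * q ^ (2 * j) := by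
    simp only [zpow_add₀ hq, zpow_sub₀ hq, zpow_natCast, two_mul, pow_add, zpow_ofNat]
    field_simp
  have a15 : q ^ (1 - 2 * m + 2 * j : ℤ) * c ^ 2 = c ^ 2 / q ^ (2 * m) * q ^ (2 * j) * q := by
    simp only [zpow_add₀ hq, zpow_sub₀ hq, zpow_natCast, zpow_one, two_mul, pow_add]
    field_simp
  rw [a1, a2, a4, a5, a6, a7, a8, a9, a10, a11, a12, a13, a14, a15, a3, a3, a3, ← qPoch_mul_neg]
  simp only [qFrac, List.map_cons, List.map_nil, List.prod_cons, List.prod_nil, mul_one]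
  rw [mul_assoc (_ * _) (a ^ i), mul_comm (a ^ i), ← mul_assoc (_ * _) (c ^ _),
    mul_assoc _ _ (c ^ _), hC, mul_pow (-a), neg_pow a, pow_add (-1) i j]
  simp only [div_eq_mul_inv, mul_inv]
  ring

/-- The identity for parameters at which no product occurring in the proof vanishes: Sears'
transformation, then `base_switch`, then `quadratic_expansion` for each `i`. -/
theorem lhsSum_eq_rhsSum_of_generic (hq : q ≠ 0) (h1 : ∀ k : ℕ, q ^ (k + 1) ≠ 1) {a c : ℂ}
    (ha : a ≠ 0) (hc : c ≠ 0) (haf : QFree q (a ^ 2)) (hcf : QFree q (c ^ 2))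
    (hacf : QFree q (a ^ 2 * c ^ 2)) (hadc : QFree q (a ^ 2 / c ^ 2)) (n l m : ℕ) :
    lhsSum n l m q a c = rhsSum n l m q a c := by
  have hqn : q ^ n ≠ 0 := pow_ne_zero _ hq
  have hql : q ^ l ≠ 0 := pow_ne_zero _ hq
  have hqm : q ^ m ≠ 0 := pow_ne_zero _ hq
  have fa : QFree q a := haf.of_sq
  have fc : QFree q c := hcf.of_sq
  have fE : QFree q (-(a * c)) := QFree.of_sq (by rwa [neg_sq, mul_pow])
  have fD : QFree q (q * q ^ l * (q ^ n)⁻¹ / a) := by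
    have := fa.inv.mul_zpow hq (1 + l - n)
    rw [zpow_sub₀ hq, zpow_add₀ hq, zpow_one, zpow_natCast, zpow_natCast] at this
    convert this using 1
    field_simp
  have fF : QFree q (q * q ^ m * (q ^ n)⁻¹ / c) := by
    have := fc.inv.mul_zpow hq (1 + m - n)
    rw [zpow_sub₀ hq, zpow_add₀ hq, zpow_one, zpow_natCast, zpow_natCast] at this
    convert this using 1
    field_simp
  have fg : QFree q (a * (-(q * q ^ l * q ^ m * (q ^ n)⁻¹ / (a * c))) /
      (q * q ^ l * (q ^ n)⁻¹ / a)) := by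
    have : QFree q (-(a / c)) := QFree.of_sq (by rwa [neg_sq, div_pow])
    convert this.mul_pow hq m using 1
    field_simp
  have fAE : QFree q (c / (-(a * c))) := by
    have : QFree q (-a) := QFree.of_sq (by rwa [neg_sq])
    convert this.inv using 1
    field_simp
  have fAF : QFree q (c / (q * q ^ m * (q ^ n)⁻¹ / c)) := by
    have := hcf.mul_zpow hq (n - m - 1)
    rw [zpow_sub₀ hq, zpow_sub₀ hq, zpow_one, zpow_natCast, zpow_natCast] at this
    convert this using 1
    field_simp
  have z1 : q ^ (-n : ℤ) = (q ^ n)⁻¹ := by rw [zpow_neg, zpow_natCast]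
  have z2 : -q ^ (1 + l + m - n : ℤ) / (a * c) = -(q * q ^ l * q ^ m * (q ^ n)⁻¹ / (a * c)) := by
    rw [zpow_sub₀ hq, zpow_add₀ hq, zpow_add₀ hq, zpow_one]
    simp only [zpow_natCast]
    field_simp
  have z3 (r : ℕ) : q ^ (1 + r - n : ℤ) = q * q ^ r * (q ^ n)⁻¹ := by
    rw [zpow_sub₀ hq, zpow_add₀ hq, zpow_one]
    simp only [zpow_natCast]
    field_simp
  have z4 : q ^ (1 + l : ℤ) = q * q ^ l := by
    rw [zpow_add₀ hq, zpow_one, zpow_natCast]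
  have z5 : q ^ (1 - n : ℤ) = q * (q ^ n)⁻¹ := by
    rw [zpow_sub₀ hq, zpow_one, zpow_natCast, div_eq_mul_inv]
  have z6 : q ^ (-m : ℤ) = (q ^ m)⁻¹ := by rw [zpow_neg, zpow_natCast]
  have hS := sears hq h1 (A := c) (B := a)
    (C := -(q * q ^ l * q ^ m * (q ^ n)⁻¹ / (a * c))) (D := q * q ^ l * (q ^ n)⁻¹ / a)
    (E := -(a * c)) (F := q * q ^ m * (q ^ n)⁻¹ / c) n (by field_simp) hc ha
    (by simp [*]) (by simp [*]) (by simp [*]) (by simp [*]) fD fE fF fg fAE fAF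
  have hL : lhsSum n l m q a c = ∑ k ∈ range (n + 1), qPoch (q ^ n)⁻¹ q k * qPoch c q k *
      qPoch a q k * qPoch (-(q * q ^ l * q ^ m * (q ^ n)⁻¹ / (a * c))) q k /
      (qPoch q q k * qPoch (q * q ^ l * (q ^ n)⁻¹ / a) q k * qPoch (-(a * c)) q k *
        qPoch (q * q ^ m * (q ^ n)⁻¹ / c) q k) * q ^ k := by
    rw [lhsSum, z1, z2, z3, z3]
    refine sum_congr rfl fun k _ => ?_
    simp only [qFrac, List.map_cons, List.map_nil, List.prod_cons, List.prod_nil, mul_one]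
    congr 2 <;> ring
  rw [hL, hS, show -(a * c) / c = -a by field_simp,
    show c * q / (q * q ^ m * (q ^ n)⁻¹ / c * q ^ n) = c ^ 2 / q ^ m by field_simp,
    show q / (q * q ^ m * (q ^ n)⁻¹ / c * q ^ n) = c / q ^ m by field_simp,
    show q * q ^ l * (q ^ n)⁻¹ / a / a = q * q ^ l * (q ^ n)⁻¹ / a ^ 2 by field_simp,
    show q * q ^ l * (q ^ n)⁻¹ / a / -(q * q ^ l * q ^ m * (q ^ n)⁻¹ / (a * c)) = -(c / q ^ m) by
      field_simp,
    show c * q / (-(a * c) * q ^ n) = -(q * (q ^ n)⁻¹ / a) by field_simp]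
  have hB := base_switch hq h1 ha haf l n (fun k => qPoch c q k * qPoch (-(c / q ^ m)) q k /
    (qPoch q q k * qPoch (c ^ 2 / q ^ m) q k) * q ^ k)
  rw [prefactor_eq hq ha haf] at hB
  have hR : ∀ k, qPoch (q ^ n)⁻¹ q k * qPoch c q k *
      qPoch (q * q ^ l * (q ^ n)⁻¹ / a ^ 2) q k * qPoch (-(c / q ^ m)) q k /
      (qPoch q q k * qPoch (q * q ^ l * (q ^ n)⁻¹ / a) q k * qPoch (-(q * (q ^ n)⁻¹ / a)) q k *
        qPoch (c ^ 2 / q ^ m) q k) * q ^ k =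
      qPoch (q ^ n)⁻¹ q k * qPoch (q * q ^ l * (q ^ n)⁻¹ / a ^ 2) q k /
        (qPoch (q * q ^ l * (q ^ n)⁻¹ / a) q k * qPoch (-(q * (q ^ n)⁻¹ / a)) q k) *
      (qPoch c q k * qPoch (-(c / q ^ m)) q k /
        (qPoch q q k * qPoch (c ^ 2 / q ^ m) q k) * q ^ k) := by
    intro k
    simp only [div_eq_mul_inv, mul_inv]; ring
  rw [sum_congr rfl fun k _ => hR k, hB, rhsSum, prefactor, z3, z4, z5, z6,
    show (q ^ m)⁻¹ * c ^ 2 = c ^ 2 / q ^ m by field_simp,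
    show (q ^ m)⁻¹ * c = c / q ^ m by field_simp, ← mul_assoc]
  congr 1
  · simp only [qFrac, List.map_cons, List.map_nil, List.prod_cons, List.prod_nil, mul_one]
    ring
  refine sum_congr rfl fun i _ => ?_
  split_ifs with hi
  · have he : QFree q ((q * q ^ l * (q ^ n)⁻¹ / a) ^ 2) := by
      have := haf.inv.mul_zpow hq (2 * (1 + l - n))
      rw [mul_comm (2 : ℤ), zpow_mul, z3, zpow_ofNat] at this
      convert this using 1
      field_simp
    have hX := quadratic_expansion hq h1 hc he hcf m (n - i)
    have hv : q * q ^ (2 * l) * (q ^ n)⁻¹ / a ^ 2 / q ^ i =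
        (q * q ^ l * (q ^ n)⁻¹ / a) ^ 2 * q ^ (n - i) / q := by
      have hn : q ^ n = q ^ (n - i) * q ^ i := by rw [← pow_add, Nat.sub_add_cancel hi]
      have := pow_ne_zero i hq
      have := pow_ne_zero (n - i) hq
      rw [hn, mul_comm 2 l, pow_mul]
      field_simp
    have hR2 : ∀ k, qPoch (q ^ (n - i))⁻¹ q k *
        qPoch ((q * q ^ l * (q ^ n)⁻¹ / a) ^ 2 * q ^ (n - i) / q) q k /
          qPoch ((q * q ^ l * (q ^ n)⁻¹ / a) ^ 2) (q ^ 2) k *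
          (qPoch c q k * qPoch (-(c / q ^ m)) q k /
            (qPoch q q k * qPoch (c ^ 2 / q ^ m) q k) * q ^ k) =
        qPoch (q ^ (n - i))⁻¹ q k *
          qPoch ((q * q ^ l * (q ^ n)⁻¹ / a) ^ 2 * q ^ (n - i) / q) q k * qPoch c q k *
        qPoch (-(c / q ^ m)) q k /
        (qPoch q q k * qPoch ((q * q ^ l * (q ^ n)⁻¹ / a) ^ 2) (q ^ 2) k *
          qPoch (c ^ 2 / q ^ m) q k) * q ^ k := by
      intro k
      simp only [div_eq_mul_inv, mul_inv]; ring
    rw [hv, sum_congr rfl fun k _ => hR2 k, hX, mul_sum]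
    refine sum_congr rfl fun j _ => ?_
    by_cases hj : i + j ≤ n ∧ Even (n - i - j)
    · rw [if_pos hj, if_pos ⟨by omega, hj.2⟩, rhsTerm_eq hq ha hc hj.1 hj.2]
    · rw [if_neg hj, if_neg fun h => hj ⟨by omega, h.2⟩, mul_zero]
  · exact (sum_eq_zero fun j _ => if_neg fun h => hi (by omega)).symm

/-! ### Vanishing terms -/

/-- The series on the left terminates because of the parameter `q^{-n}`. -/
theorem basicHyp_eq_lhsSum (hq : q ≠ 0) (n l m : ℕ) (a c : ℂ) :
    basicHyp q q
        [q ^ (-n : ℤ), a, c, -q ^ (1 + l + m - n : ℤ) / (a * c)]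
        [q ^ (1 + l - n : ℤ) / a, q ^ (1 + m - n : ℤ) / c, -(a * c)] = lhsSum n l m q a c := by
  refine tsum_eq_sum fun k hk => ?_
  have : qPoch (q ^ (-n : ℤ)) q k = 0 := by
    rw [zpow_neg, zpow_natCast]
    exact qPoch_inv_pow_eq_zero hq (by simpa using hk)
  simp only [qFrac, List.map_cons, List.prod_cons, this, zero_mul, zero_div]

theorem rhsTerm_eq_zero (hq : q ≠ 0) {a c : ℂ} {n l m i j : ℕ}
    (h : ¬(i + j ≤ n ∧ Even (n - i - j))) : rhsTerm n l m i j q a c = 0 := by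
  rcases lt_or_ge n i with hi | hi
  · have : qPoch (q ^ (-n : ℤ)) q i = 0 := by
      rw [zpow_neg, zpow_natCast]
      exact qPoch_inv_pow_eq_zero hq hi
    simp only [rhsTerm, qFrac, List.map_cons, List.prod_cons, this, zero_mul, mul_zero, zero_div]
  rcases lt_or_ge n (i + j) with hj | hj
  · have : qPoch (q ^ (i - n : ℤ)) q j = 0 := by
      rw [show (i - n : ℤ) = -((n - i : ℕ) : ℤ) by omega, zpow_neg, zpow_natCast]
      exact qPoch_inv_pow_eq_zero hq (by omega)
    simp only [rhsTerm, qFrac, List.map_cons, List.prod_cons, this, zero_mul, mul_zero, zero_div]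
  · have hO : Odd (n - i - j) := by
      rw [← Nat.not_even_iff_odd]; exact fun hE => h ⟨hj, hE⟩
    have : parityChi (n - i - j) = 0 := by
      rw [parityChi, show (n - i - j : ℤ) = ((n - i - j : ℕ) : ℤ) by omega, zpow_natCast,
        hO.neg_one_pow]
      norm_num
    rw [rhsTerm, this, mul_zero]

/-! ### Density of the generic parameters and continuity of both sides -/

theorem countable_setOf_pow_eq {ι : Type*} [Countable ι] (b : ι → ℂ) (d : ι → ℕ)
    (hd : ∀ k, 0 < d k) : {x : ℂ | ∃ k, x ^ d k = b k}.Countable := by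
  rw [Set.ofPred_exists]
  refine Set.countable_iUnion fun k => Set.Finite.countable ?_
  refine (Polynomial.nthRoots (d k) (b k)).toFinset.finite_toSet.subset fun x hx => ?_
  simpa [Polynomial.mem_nthRoots (hd k)] using hx

/-- Parameters for which every product in the denominators of the proof is nonzero. -/
structure IsGeneric (q a c : ℂ) : Prop where
  q_ne_zero : q ≠ 0
  q_pow_ne_one : ∀ k : ℕ, q ^ (k + 1) ≠ 1
  a_ne_zero : a ≠ 0
  c_ne_zero : c ≠ 0
  a_sq : QFree q (a ^ 2)
  c_sq : QFree q (c ^ 2)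
  mul_sq : QFree q (a ^ 2 * c ^ 2)
  div_sq : QFree q (a ^ 2 / c ^ 2)

/-- Generic parameters are dense: `q`, `a` and `c` are chosen one after the other, each avoiding a
countable set. -/
theorem frequently_isGeneric (p : ℂ × ℂ × ℂ) : ∃ᶠ x in 𝓝 p, IsGeneric x.1 x.2.1 x.2.2 := by
  rw [Metric.nhds_basis_ball.frequently_iff]
  intro ε hε
  obtain ⟨q, hq, hqd⟩ := (((Set.countable_singleton (0 : ℂ)).union (countable_setOf_pow_eq
    (fun _ : ℕ => 1) (fun k => k + 1) fun k => k.succ_pos)).dense_compl ℝ).exists_dist_lt p.1 hε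
  obtain ⟨a, ha, had⟩ := (((Set.countable_singleton (0 : ℂ)).union (countable_setOf_pow_eq
    (fun k : ℤ => (q ^ k)⁻¹) (fun _ => 2) fun k => two_pos)).dense_compl ℝ).exists_dist_lt p.2.1 hε
  obtain ⟨c, hc, hcd⟩ := (((Set.countable_singleton (0 : ℂ)).union ((countable_setOf_pow_eq
    (fun k : ℤ => (q ^ k)⁻¹) (fun _ => 2) fun k => two_pos).union ((countable_setOf_pow_eq
    (fun k : ℤ => (a ^ 2 * q ^ k)⁻¹) (fun _ => 2) fun k => two_pos).union (countable_setOf_pow_eq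
    (fun k : ℤ => a ^ 2 * q ^ k) (fun _ => 2) fun k => two_pos)))).dense_compl
      ℝ).exists_dist_lt p.2.2 hε
  simp only [Set.mem_compl_iff, Set.mem_union, Set.mem_singleton_iff, Set.mem_ofPred_eq, not_or,
    not_exists] at hq ha hc
  refine ⟨(q, a, c), ?_, hq.1, hq.2, ha.1, hc.1, fun k hk => ha.2 k (eq_inv_of_mul_eq_one_left hk),
    fun k hk => hc.2.1 k (eq_inv_of_mul_eq_one_left hk), fun k hk => hc.2.2.1 k ?_,
    fun k hk => hc.2.2.2 k ?_⟩
  · rw [dist_comm] at hqd had hcd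
    simp only [Metric.mem_ball, Prod.dist_eq, sup_lt_iff]
    exact ⟨hqd, had, hcd⟩
  · exact eq_inv_of_mul_eq_one_left (by rw [← hk]; ring)
  · have := hc.1
    field_simp at hk
    exact hk.symm

theorem continuousAt_qPoch {X : Type*} [TopologicalSpace X] {f g : X → ℂ} {x : X}
    (hf : ContinuousAt f x) (hg : ContinuousAt g x) (n : ℕ) :
    ContinuousAt (fun y => qPoch (f y) (g y) n) x := by
  unfold qPoch
  exact tendsto_finsetProd _ fun k _ => (continuousAt_const.sub (hf.mul (hg.pow k)))

theorem continuousAt_qFrac {X : Type*} [TopologicalSpace X] {g : X → ℂ} {x : X}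
    (hg : ContinuousAt g x) (num den : List (X → ℂ)) (n : ℕ)
    (hnum : ∀ f ∈ num, ContinuousAt f x) (hden : ∀ f ∈ den, ContinuousAt f x)
    (h0 : NoZeroDen (g x) (den.map fun f => f x) n) :
    ContinuousAt (fun y => qFrac (g y) (num.map fun f => f y) (den.map fun f => f y) n) x := by
  have key : ∀ L : List (X → ℂ), (∀ f ∈ L, ContinuousAt f x) → ContinuousAt
      (fun y => ((L.map fun f => f y).map fun z => qPoch z (g y) n).prod) x := by
    intro L hL
    simp only [List.map_map]
    exact tendsto_list_prod L fun f hf => continuousAt_qPoch (hL f hf) hg n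
  refine (key num hnum).div (key den hden) ?_
  refine List.prod_ne_zero fun h => ?_
  obtain ⟨z, hz, hz0⟩ := List.mem_map.1 h
  exact h0 z hz hz0

theorem NoZeroDen.mono {den : List ℂ} {n k : ℕ} (h : NoZeroDen q den n) (hk : k ≤ n) :
    NoZeroDen q den k := by
  obtain ⟨r, rfl⟩ := Nat.exists_eq_add_of_le hk
  intro x hx h0
  exact h x hx (by rw [qPoch_add, h0, zero_mul])

theorem continuousAt_lhsSum {a c : ℂ} (hq : q ≠ 0) (ha : a ≠ 0) (hc : c ≠ 0) {n l m : ℕ}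
    (hL : NoZeroDen q [q, q ^ (1 + l - n : ℤ) / a, q ^ (1 + m - n : ℤ) / c, -(a * c)] n) :
    ContinuousAt (fun p : ℂ × ℂ × ℂ => lhsSum n l m p.1 p.2.1 p.2.2) (q, a, c) := by
  have h1 : ContinuousAt (fun p : ℂ × ℂ × ℂ => p.1) (q, a, c) := by fun_prop
  have ha' : ContinuousAt (fun p : ℂ × ℂ × ℂ => p.2.1) (q, a, c) := by fun_prop
  have hc' : ContinuousAt (fun p : ℂ × ℂ × ℂ => p.2.2) (q, a, c) := by fun_prop
  have hz (z : ℤ) : ContinuousAt (fun p : ℂ × ℂ × ℂ => p.1 ^ z) (q, a, c) :=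
    h1.zpow₀ z (Or.inl hq)
  refine tendsto_finsetSum _ fun k hk => ContinuousAt.mul ?_ (h1.pow k)
  refine continuousAt_qFrac h1
    [fun p => p.1 ^ (-n : ℤ), fun p => p.2.1, fun p => p.2.2,
      fun p => -p.1 ^ (1 + l + m - n : ℤ) / (p.2.1 * p.2.2)]
    [fun p => p.1, fun p => p.1 ^ (1 + l - n : ℤ) / p.2.1, fun p => p.1 ^ (1 + m - n : ℤ) / p.2.2,
      fun p => -(p.2.1 * p.2.2)] k ?_ ?_ (hL.mono (Nat.lt_succ_iff.1 (mem_range.1 hk)))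
  · simp only [List.forall_mem_cons, List.not_mem_nil, false_imp_iff, implies_true, and_true]
    exact ⟨hz _, ha', hc', (hz _).neg.div (ha'.mul hc') (mul_ne_zero ha hc)⟩
  · simp only [List.forall_mem_cons, List.not_mem_nil, false_imp_iff, implies_true, and_true]
    exact ⟨h1, (hz _).div ha' ha, (hz _).div hc' hc, (ha'.mul hc').neg⟩

theorem continuousAt_prefactor {a c : ℂ} (hq : q ≠ 0) (ha : a ≠ 0) {n l m : ℕ}
    (hP : NoZeroDen q [q ^ (1 + l : ℤ) / a ^ 2, -q ^ (1 - n : ℤ) / a] l)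
    (hP' : NoZeroDen q [-(a * c), q ^ (-m : ℤ) * c] n) :
    ContinuousAt (fun p : ℂ × ℂ × ℂ => prefactor n l m p.1 p.2.1 p.2.2) (q, a, c) := by
  have h1 : ContinuousAt (fun p : ℂ × ℂ × ℂ => p.1) (q, a, c) := by fun_prop
  have ha' : ContinuousAt (fun p : ℂ × ℂ × ℂ => p.2.1) (q, a, c) := by fun_prop
  have hc' : ContinuousAt (fun p : ℂ × ℂ × ℂ => p.2.2) (q, a, c) := by fun_prop
  have hz (z : ℤ) : ContinuousAt (fun p : ℂ × ℂ × ℂ => p.1 ^ z) (q, a, c) :=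
    h1.zpow₀ z (Or.inl hq)
  have ha2 : a ^ 2 ≠ 0 := pow_ne_zero 2 ha
  refine ContinuousAt.mul ?_ ?_
  · refine continuousAt_qFrac h1
      [fun p => p.1 ^ (1 + l - n : ℤ) / p.2.1 ^ 2, fun p => -p.1 / p.2.1]
      [fun p => p.1 ^ (1 + l : ℤ) / p.2.1 ^ 2, fun p => -p.1 ^ (1 - n : ℤ) / p.2.1] l ?_ ?_ hP
    · simp only [List.forall_mem_cons, List.not_mem_nil, false_imp_iff, implies_true, and_true]
      exact ⟨(hz _).div (ha'.pow 2) ha2, h1.neg.div ha' ha⟩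
    · simp only [List.forall_mem_cons, List.not_mem_nil, false_imp_iff, implies_true, and_true]
      exact ⟨(hz _).div (ha'.pow 2) ha2, (hz _).neg.div ha' ha⟩
  · refine continuousAt_qFrac h1
      [fun p => -p.2.1, fun p => p.1 ^ (-m : ℤ) * p.2.2 ^ 2]
      [fun p => -(p.2.1 * p.2.2), fun p => p.1 ^ (-m : ℤ) * p.2.2] n ?_ ?_ hP'
    · simp only [List.forall_mem_cons, List.not_mem_nil, false_imp_iff, implies_true, and_true]
      exact ⟨ha'.neg, (hz _).mul (hc'.pow 2)⟩
    · simp only [List.forall_mem_cons, List.not_mem_nil, false_imp_iff, implies_true, and_true]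
      exact ⟨(ha'.mul hc').neg, (hz _).mul hc'⟩

theorem continuousAt_rhsTerm {a c : ℂ} (hq : q ≠ 0) (ha : a ≠ 0) (hc : c ≠ 0) {n l m i j : ℕ}
    (hS : 1 - q ^ (-2 * l - 1 : ℤ) * a ^ 2 ≠ 0)
    (hi : NoZeroDen q [q, q ^ (n - 2 * l : ℤ) * a ^ 2, q ^ (-l : ℤ) * a ^ 2] i)
    (hj : NoZeroDen q [q, q ^ (1 + l - n : ℤ) / a, -q ^ (1 + l - n : ℤ) / a,
        q ^ (-m : ℤ) * c ^ 2, q ^ (j - 2 * m - 1 : ℤ) * c ^ 2] j)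
    (hij : NoZeroDen (q ^ 2) [q ^ (2 + 2 * l - 2 * n + 2 * j : ℤ) / a ^ 2,
        q ^ (1 - 2 * m + 2 * j : ℤ) * c ^ 2] ((n - i - j) / 2)) :
    ContinuousAt (fun p : ℂ × ℂ × ℂ => rhsTerm n l m i j p.1 p.2.1 p.2.2) (q, a, c) := by
  have h1 : ContinuousAt (fun p : ℂ × ℂ × ℂ => p.1) (q, a, c) := by fun_prop
  have ha' : ContinuousAt (fun p : ℂ × ℂ × ℂ => p.2.1) (q, a, c) := by fun_prop
  have hc' : ContinuousAt (fun p : ℂ × ℂ × ℂ => p.2.2) (q, a, c) := by fun_prop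
  have hz (z : ℤ) : ContinuousAt (fun p : ℂ × ℂ × ℂ => p.1 ^ z) (q, a, c) :=
    h1.zpow₀ z (Or.inl hq)
  have ha2 : a ^ 2 ≠ 0 := pow_ne_zero 2 ha
  have hac : a ^ 2 * c ^ 2 ≠ 0 := mul_ne_zero ha2 (pow_ne_zero 2 hc)
  refine ContinuousAt.mul (ContinuousAt.mul (ContinuousAt.mul (ContinuousAt.mul
    (ContinuousAt.mul (ContinuousAt.mul (ContinuousAt.mul (continuousAt_const.mul (hz _))
      (ha'.pow i)) (hc'.zpow₀ _ (Or.inl hc))) ?_) ?_) ?_) ?_) continuousAt_const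
  · exact (continuousAt_const.sub ((hz _).mul (ha'.pow 2))).div
      (continuousAt_const.sub ((hz _).mul (ha'.pow 2))) hS
  · refine continuousAt_qFrac h1
      [fun p => p.1 ^ (-l : ℤ), fun p => p.1 ^ (-n : ℤ),
        fun p => p.1 ^ (-2 * l - 1 : ℤ) * p.2.1 ^ 2]
      [fun p => p.1, fun p => p.1 ^ (n - 2 * l : ℤ) * p.2.1 ^ 2,
        fun p => p.1 ^ (-l : ℤ) * p.2.1 ^ 2] i ?_ ?_ hi
    · simp only [List.forall_mem_cons, List.not_mem_nil, false_imp_iff, implies_true, and_true]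
      exact ⟨hz _, hz _, (hz _).mul (ha'.pow 2)⟩
    · simp only [List.forall_mem_cons, List.not_mem_nil, false_imp_iff, implies_true, and_true]
      exact ⟨h1, (hz _).mul (ha'.pow 2), (hz _).mul (ha'.pow 2)⟩
  · refine continuousAt_qFrac h1
      [fun p => p.1 ^ (-m : ℤ), fun p => p.1 ^ (i - n : ℤ),
        fun p => p.1 ^ (1 + 2 * l - n - i : ℤ) / p.2.1 ^ 2,
        fun p => p.1 ^ (-m : ℤ) * p.2.2, fun p => -p.1 ^ (-m : ℤ) * p.2.2]
      [fun p => p.1, fun p => p.1 ^ (1 + l - n : ℤ) / p.2.1,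
        fun p => -p.1 ^ (1 + l - n : ℤ) / p.2.1, fun p => p.1 ^ (-m : ℤ) * p.2.2 ^ 2,
        fun p => p.1 ^ (j - 2 * m - 1 : ℤ) * p.2.2 ^ 2] j ?_ ?_ hj
    · simp only [List.forall_mem_cons, List.not_mem_nil, false_imp_iff, implies_true, and_true]
      exact ⟨hz _, hz _, (hz _).div (ha'.pow 2) ha2, (hz _).mul hc', (hz _).neg.mul hc'⟩
    · simp only [List.forall_mem_cons, List.not_mem_nil, false_imp_iff, implies_true, and_true]
      exact ⟨h1, (hz _).div ha' ha, (hz _).neg.div ha' ha, (hz _).mul (hc'.pow 2),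
        (hz _).mul (hc'.pow 2)⟩
  · refine continuousAt_qFrac (h1.pow 2)
      [fun p => p.1, fun p => p.1 ^ (2 + 2 * l + 2 * m - 2 * n : ℤ) / (p.2.1 ^ 2 * p.2.2 ^ 2)]
      [fun p => p.1 ^ (2 + 2 * l - 2 * n + 2 * j : ℤ) / p.2.1 ^ 2,
        fun p => p.1 ^ (1 - 2 * m + 2 * j : ℤ) * p.2.2 ^ 2] _ ?_ ?_ hij
    · simp only [List.forall_mem_cons, List.not_mem_nil, false_imp_iff, implies_true, and_true]
      exact ⟨h1, (hz _).div ((ha'.pow 2).mul (hc'.pow 2)) hac⟩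
    · simp only [List.forall_mem_cons, List.not_mem_nil, false_imp_iff, implies_true, and_true]
      exact ⟨(hz _).div (ha'.pow 2) ha2, (hz _).mul (hc'.pow 2)⟩

/- Exponents are integers. In a summand with `i + j > n` the factor `(q^(-n);q)_i` or
`(q^(i-n);q)_j` is zero, and in one with `n - i - j` odd the factor `χ` is zero, so that the
truncated order `(n - i - j) / 2` matters only where it is the true one. -/

end

/- Exponents are integers. In a summand with `i + j > n` the factor `(q^(-n);q)_i` or
`(q^(i-n);q)_j` is zero, and in one with `n - i - j` odd the factor `χ` is zero, so that the
truncated order `(n - i - j) / 2` matters only where it is the true one. -/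
theorem theorem4 (q a c : ℂ) (n ℓ m : ℕ) (hq : q ≠ 0) (ha : a ≠ 0) (hc : c ≠ 0)
    -- no zero denominators in the terms `k ≤ n` of the series on the left
    (hL : NoZeroDen q [q, q ^ (1 + ℓ - n : ℤ) / a, q ^ (1 + m - n : ℤ) / c, -(a * c)] n)
    -- no zero denominators in the factors in front of the double sum
    (hP : NoZeroDen q [q ^ (1 + ℓ : ℤ) / a ^ 2, -q ^ (1 - n : ℤ) / a] ℓ)
    (hP' : NoZeroDen q [-(a * c), q ^ (-m : ℤ) * c] n)
    -- no zero denominators in the double sum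
    (hS : 1 - q ^ (-2 * ℓ - 1 : ℤ) * a ^ 2 ≠ 0)
    (hi : ∀ i : ℕ, i ≤ ℓ → i ≤ n →
      NoZeroDen q [q, q ^ (n - 2 * ℓ : ℤ) * a ^ 2, q ^ (-ℓ : ℤ) * a ^ 2] i)
    (hj : ∀ j : ℕ, j ≤ m → j ≤ n →
      NoZeroDen q [q, q ^ (1 + ℓ - n : ℤ) / a, -q ^ (1 + ℓ - n : ℤ) / a,
        q ^ (-m : ℤ) * c ^ 2, q ^ (j - 2 * m - 1 : ℤ) * c ^ 2] j)
    (hij : ∀ i j : ℕ, i ≤ ℓ → j ≤ m → i + j ≤ n → Even (n - i - j) →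
      NoZeroDen (q ^ 2) [q ^ (2 + 2 * ℓ - 2 * n + 2 * j : ℤ) / a ^ 2,
        q ^ (1 - 2 * m + 2 * j : ℤ) * c ^ 2] ((n - i - j) / 2)) :
    basicHyp q q
        [q ^ (-n : ℤ), a, c, -q ^ (1 + ℓ + m - n : ℤ) / (a * c)]
        [q ^ (1 + ℓ - n : ℤ) / a, q ^ (1 + m - n : ℤ) / c, -(a * c)] =
      qFrac q [q ^ (1 + ℓ - n : ℤ) / a ^ 2, -q / a]
          [q ^ (1 + ℓ : ℤ) / a ^ 2, -q ^ (1 - n : ℤ) / a] ℓ *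
        qFrac q [-a, q ^ (-m : ℤ) * c ^ 2] [-(a * c), q ^ (-m : ℤ) * c] n *
        ∑ i ∈ Finset.range (ℓ + 1), ∑ j ∈ Finset.range (m + 1),
          (-1) ^ (i + j) *
          q ^ ((n * i + (n - i - j) * (j - m) + ((j + 1).choose 2 : ℕ) : ℤ)) *
          a ^ i * c ^ (n - i : ℤ) *
          ((1 - q ^ (2 * i - 2 * ℓ - 1 : ℤ) * a ^ 2) / (1 - q ^ (-2 * ℓ - 1 : ℤ) * a ^ 2)) *
          qFrac q [q ^ (-ℓ : ℤ), q ^ (-n : ℤ), q ^ (-2 * ℓ - 1 : ℤ) * a ^ 2]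
            [q, q ^ (n - 2 * ℓ : ℤ) * a ^ 2, q ^ (-ℓ : ℤ) * a ^ 2] i *
          qFrac q [q ^ (-m : ℤ), q ^ (i - n : ℤ), q ^ (1 + 2 * ℓ - n - i : ℤ) / a ^ 2,
              q ^ (-m : ℤ) * c, -q ^ (-m : ℤ) * c]
            [q, q ^ (1 + ℓ - n : ℤ) / a, -q ^ (1 + ℓ - n : ℤ) / a,
              q ^ (-m : ℤ) * c ^ 2, q ^ (j - 2 * m - 1 : ℤ) * c ^ 2] j *
          qFrac (q ^ 2) [q, q ^ (2 + 2 * ℓ + 2 * m - 2 * n : ℤ) / (a ^ 2 * c ^ 2)]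
            [q ^ (2 + 2 * ℓ - 2 * n + 2 * j : ℤ) / a ^ 2, q ^ (1 - 2 * m + 2 * j : ℤ) * c ^ 2]
            ((n - i - j) / 2) *
          parityChi (n - i - j) := by
  rw [basicHyp_eq_lhsSum hq]
  have hR : ∑ i ∈ Finset.range (ℓ + 1), ∑ j ∈ Finset.range (m + 1), rhsTerm n ℓ m i j q a c =
      ∑ i ∈ Finset.range (ℓ + 1), ∑ j ∈ Finset.range (m + 1),
        if i + j ≤ n ∧ Even (n - i - j) then rhsTerm n ℓ m i j q a c else 0 := by
    refine Finset.sum_congr rfl fun i _ => Finset.sum_congr rfl fun j _ => ?_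
    split_ifs with h
    · rfl
    · exact rhsTerm_eq_zero hq h
  suffices h : lhsSum n ℓ m q a c = rhsSum n ℓ m q a c by
    rw [h, rhsSum, ← hR]
    rfl
  have hcR : ContinuousAt (fun p : ℂ × ℂ × ℂ => rhsSum n ℓ m p.1 p.2.1 p.2.2) (q, a, c) := by
    refine (continuousAt_prefactor hq ha hP hP').mul
      (tendsto_finsetSum _ fun i hi' => tendsto_finsetSum _ fun j hj' => ?_)
    have hil := Nat.lt_succ_iff.1 (Finset.mem_range.1 hi')
    have hjm := Nat.lt_succ_iff.1 (Finset.mem_range.1 hj')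
    by_cases h : i + j ≤ n ∧ Even (n - i - j)
    · simp only [if_pos h]
      exact continuousAt_rhsTerm hq ha hc hS (hi i hil (by omega)) (hj j hjm (by omega))
        (hij i j hil hjm h.1 h.2)
    · simp only [if_neg h]
      exact tendsto_const_nhds
  -- A nonzero difference of the two sides would stay nonzero near `(q, a, c)`, in particular at
  -- some generic point.
  by_contra hne
  have hev := ((continuousAt_lhsSum hq ha hc hL).sub hcR).eventually_ne (sub_ne_zero.2 hne)
  obtain ⟨p, hp, hg⟩ := ((frequently_isGeneric (q, a, c)).and_eventually hev).exists
  exact hg (sub_eq_zero.2 (lhsSum_eq_rhsSum_of_generic hp.q_ne_zero hp.q_pow_ne_one hp.a_ne_zero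
    hp.c_ne_zero hp.a_sq hp.c_sq hp.mul_sq hp.div_sq n ℓ m))
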